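/- Let $d\ge 1$ and, for $l\ge 1$, let $\Lambda_l:=(-l/2,l/2)^d\subset\mathbb{R}^d$. Let $f:\Lambda_1\to\mathbb{R}$ be a bounded measurable function such that, for some $\sigma>0$, $f(x)\ge\sigma$ for all $x\in\Lambda_1$; extend $f$ by zero to $\mathbb{R}^d$. Let $\mu$ be a probability measure on $\mathbb{R}$ with $\operatorname{supp}\mu=[0,a]$ for some finite $a$, which is Hölder continuous in the sense that, for some $\alpha>0$, $$\sup\{\mu([s,t]) : 0\le t-s\le\eta\}\le\eta^{\alpha}\qquad\text{for all } 0\le\eta\le 1 .$$ Let $(q(k))_{k\in\mathbb{Z}^d}$ be independent random variables on a probability space $(\Omega,\mathcal{F},\mathbb{P})$, each with law $\mu$, and let $$v^{\omega}(x):=\sum_{k\in\mathbb{Z}^d}q^{\omega}(k)\,f(x-k),\qquad x\in\mathbb{R}^d .$$ For $l\ge 1$ let $h_l^{\omega}:=-\tfrac12\Delta_D+v^{\omega}$ on $L^2(\Lambda_l)$, where $\Delta_D$ is the Laplacian on $\Lambda_l$ with Dirichlet boundary conditions. Then, with probability one, the following holds. For every real $l\ge 1$, the space $L^2(\Lambda_l)$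 has an orthonormal basis of eigenfunctions of $h_l^{\omega}$ whose eigenvalues, counted with multiplicity, can be ordered as $E_1^{\omega,l}\le E_2^{\omega,l}\le E_3^{\omega,l}\le\cdots$; and for each $i\ge 1$, $$\lim_{l\to\infty}E_i^{\omega,l}=0 .$$ -/

import Mathlib

open MeasureTheory ProbabilityTheory Filter Topology
open scoped ComplexConjugate

/-- The open cube `(-l/2, l/2)^d` in `ℝ^d`. -/
def cube (d : ℕ) (l : ℝ) : Set (EuclideanSpace ℝ (Fin d)) :=
  {x | ∀ j, x j ∈ Set.Ioo (-(l / 2)) (l / 2)}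

/-- Lebesgue measure on the cube of side `l`. -/
noncomputable def cubeMeasure (d : ℕ) (l : ℝ) : Measure (EuclideanSpace ℝ (Fin d)) :=
  volume.restrict (cube d l)

/-- The complex Hilbert space `L²` of the cube of side `l`. -/
abbrev CubeL2 (d : ℕ) (l : ℝ) : Type :=
  Lp ℂ 2 (cubeMeasure d l)

/-- Smooth complex functions with compact support inside the open cube of side `l`. -/
def IsTestFunction (d : ℕ) (l : ℝ) (φ : EuclideanSpace ℝ (Fin d) → ℂ) : Prop :=
  ContDiff ℝ (⊤ : ℕ∞) φ ∧ HasCompactSupport φ ∧ tsupport φ ⊆ cube d l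

/-- The classical partial derivative in the `j`-th coordinate direction. -/
noncomputable def partialDeriv {d : ℕ} (j : Fin d) (φ : EuclideanSpace ℝ (Fin d) → ℂ)
    (x : EuclideanSpace ℝ (Fin d)) : ℂ :=
  fderiv ℝ φ x (EuclideanSpace.single j 1)

/-- `u` lies in `H¹₀` of the cube (the closure of the test functions for the `H¹` norm)
and `g` is its gradient. -/
def IsH10Gradient {d : ℕ} {l : ℝ} (u : CubeL2 d l) (g : Fin d → CubeL2 d l) : Prop :=
  ∃ φ : ℕ → EuclideanSpace ℝ (Fin d) → ℂ,
    (∀ n, IsTestFunction d l (φ n)) ∧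
    Tendsto (fun n => eLpNorm (fun x => φ n x - u x) 2 (cubeMeasure d l)) atTop (𝓝 0) ∧
    ∀ j, Tendsto (fun n => eLpNorm (fun x => partialDeriv j (φ n) x - g j x) 2
      (cubeMeasure d l)) atTop (𝓝 0)

/-- The graph of the kinetic energy operator `h⁰ = -½ Δ_D` with Dirichlet boundary conditions:
`u` is in its domain and `h⁰ u = w`. It is the self-adjoint operator of the closed quadratic form
`½ ∫ |∇u|²` on `H¹₀`: the domain consists of the `u ∈ H¹₀` whose distributional Laplacian
is in `L²`. -/
def IsKineticImage {d : ℕ} {l : ℝ} (u w : CubeL2 d l) : Prop :=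
  ∃ g : Fin d → CubeL2 d l, IsH10Gradient u g ∧
    ∀ ψ : EuclideanSpace ℝ (Fin d) → ℂ, IsTestFunction d l ψ →
      (1 / 2 : ℂ) * ∑ j, ∫ x, conj (partialDeriv j ψ x) * g j x ∂(cubeMeasure d l) =
        ∫ x, conj (ψ x) * w x ∂(cubeMeasure d l)

/-- The graph of the Schrödinger operator `h = h⁰ + v` on the cube of side `l`, where `v` acts by
multiplication: `u` is in its domain and `h u = w`. -/
def IsSchrodingerImage {d : ℕ} {l : ℝ} (v : EuclideanSpace ℝ (Fin d) → ℝ)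
    (u w : CubeL2 d l) : Prop :=
  ∃ w₀ : CubeL2 d l, IsKineticImage u w₀ ∧
    ∀ᵐ x ∂(cubeMeasure d l), w x = w₀ x + (v x : ℂ) * u x

/-- `E 0 ≤ E 1 ≤ ⋯` are all the eigenvalues of the Schrödinger operator `h⁰ + v` on the cube of
side `l`, repeated according to multiplicity: they belong to an orthonormal basis of
eigenfunctions. -/
def IsEigenvalueSequence (d : ℕ) (l : ℝ) (v : EuclideanSpace ℝ (Fin d) → ℝ)
    (E : ℕ → ℝ) : Prop :=
  Monotone E ∧ ∃ φ : HilbertBasis ℕ ℂ (CubeL2 d l),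
    ∀ i, IsSchrodingerImage v (φ i) ((E i : ℂ) • φ i)

/-- The point of `ℝ^d` given by a lattice point of `ℤ^d`. -/
noncomputable def latticePoint {d : ℕ} (k : Fin d → ℤ) : EuclideanSpace ℝ (Fin d) :=
  WithLp.toLp 2 (fun j => (k j : ℝ))

/-- The potential `v(x) = ∑ₖ q(k) f(x - k)`, the sum over the lattice `ℤ^d`, where the
single-site potential `f` lives on the open unit cube and is extended by zero. For each `x` at
most one term is nonzero. -/
noncomputable def latticePotential {d : ℕ} (f : EuclideanSpace ℝ (Fin d) → ℝ)
    (q : (Fin d → ℤ) → ℝ) (x : EuclideanSpace ℝ (Fin d)) : ℝ :=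
  ∑' k : Fin d → ℤ, q k * (cube d 1).indicator f (x - latticePoint k)

/-!
The potential is almost surely bounded and nonnegative, since all coupling constants lie in the
support of `μ`.

*Existence of the eigenbasis.* For a bounded potential `v ≥ 0` on a cube, the quadratic form of
`1 + 2h` makes `H¹₀` a Hilbert space (`formSpace`). If `J` is its embedding into `L²`, then
`formResolvent = J J*` is the inverse of `1 + 2h`: the defining property of the adjoint is the weak
form of the equation (`isSchrodingerImage_formResolvent`). This operator is symmetric, it is
positive because test functions are dense, and it is compact because `J` is. Compactness of `J` is
Rellich's theorem, obtained here from the averages over a grid of side `δ`: they have finite rank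
and differ from the identity by `O(δ)` in the norm from `H¹₀` to `L²`
(`norm_formEmbedding_sub_gridAverage_le`), as an increment `φ (x + h) - φ x` has `L²` norm at most
that of the derivative of `φ` along `h`. The spectral theorem for compact symmetric operators then
yields the basis, and the eigenvalues can be listed in order because only finitely many lie below a
given bound.

*Convergence to zero.* The eigenvalues are nonnegative. For the upper bound, `0` lies in the support
of `μ`, so by the second Borel–Cantelli lemma there are almost surely, for all `N` and `ε`,
infinitely many disjoint boxes of half-width `N` on which all coupling constants are below `ε`
(`ae_frequently_forall_mem_block`). A bump `ψ` dilated to the size of such a box satisfies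
`‖h ψ‖ ≤ c ‖ψ‖` with `c = O(N⁻² + ε)`. Once the cube contains `i + 1` of these boxes, some
combination of the bumps is orthogonal to the first `i` eigenfunctions, and comparing `‖h ψ‖` with
`‖ψ‖` for this combination bounds the eigenvalue with index `i` by `c`
(`HilbertBasis.eigenvalue_le_of_orthogonal`). Here `h ψ` is the classical expression, which is
paired with the eigenfunctions through integration by parts
(`IsSchrodingerImage.inner_testFunction`).
-/

/-! ### Compact symmetric operators and their ordered eigenbases -/

/-- A real function on an infinite type whose sublevel sets are finite can be listed in increasing
order. -/
theorem exists_monotone_enumeration {ι : Type*} [Infinite ι] (m : ι → ℝ)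
    (hfin : ∀ c, {i | m i ≤ c}.Finite) : ∃ e : ℕ ≃ ι, Monotone (m ∘ e) := by
  have hcount : Countable ι := by
    have hU : (Set.univ : Set ι) = ⋃ n : ℕ, {i | m i ≤ n} := by
      ext i
      simpa using exists_nat_ge (m i)
    rw [← Set.countable_univ_iff, hU]
    exact Set.countable_iUnion fun n => (hfin n).countable
  obtain ⟨c, hc⟩ := exists_injective_nat ι
  -- ties are broken by the injection `c`
  let κ : ι → ℝ ×ₗ ℕ := fun i => toLex (m i, c i)
  have hκ : Function.Injective κ := fun i j h => hc (congrArg (fun p => (ofLex p).2) h)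
  let : LinearOrder ι := LinearOrder.lift' κ hκ
  have hmono : Monotone m := by
    intro i j hij
    have h : κ i ≤ κ j := hij
    rcases (Prod.Lex.le_iff).1 h with h | h
    · exact h.le
    · exact h.1.le
  have hIic : ∀ i : ι, (Set.Iic i).Finite := fun i =>
    (hfin (m i)).subset fun j hj => hmono hj
  let : LocallyFiniteOrder ι := LocallyFiniteOrder.ofFiniteIcc
    fun i j => (hIic j).subset Set.Icc_subset_Iic_self
  obtain ⟨b, hb⟩ : ∃ b : ι, ∀ i, b ≤ i := by
    obtain ⟨i₀⟩ : Nonempty ι := inferInstance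
    obtain ⟨b, hb, hmin⟩ :=
      Set.exists_min_image (Set.Iic i₀) id (hIic i₀) ⟨i₀, Set.mem_Iic.2 le_rfl⟩
    refine ⟨b, fun i => ?_⟩
    rcases le_total i i₀ with h | h
    · exact hmin i h
    · exact le_trans hb h
  let : OrderBot ι := { bot := b, bot_le := hb }
  have : NoMaxOrder ι := by
    refine ⟨fun i => ?_⟩
    obtain ⟨j, hj⟩ := (hIic i).infinite_compl.nonempty
    exact ⟨j, not_le.1 hj⟩
  let : SuccOrder ι := LinearLocallyFiniteOrder.succOrder ι
  let : PredOrder ι := LinearLocallyFiniteOrder.predOrder ι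
  have : IsSuccArchimedean ι := inferInstance
  exact ⟨(orderIsoNatOfLinearSuccPredArch (ι := ι)).symm.toEquiv,
    hmono.comp (orderIsoNatOfLinearSuccPredArch (ι := ι)).symm.monotone⟩

section Hilbert

variable {H : Type*} [NormedAddCommGroup H] [InnerProductSpace ℂ H]

/-- Only finitely many members of an orthonormal family of eigenvectors of a compact operator have
an eigenvalue outside a given neighbourhood of zero: their images are separated points of a compact
set. -/
theorem Orthonormal.finite_le_norm_eigenvalue {T : H →L[ℂ] H} (hT : IsCompactOperator T)
    {ι : Type*} {e : ι → H} (he : Orthonormal ℂ e) {lam : ι → ℂ}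
    (hlam : ∀ i, T (e i) = lam i • e i) {ε : ℝ} (hε : 0 < ε) : {i | ε ≤ ‖lam i‖}.Finite := by
  by_contra hinf
  have hinf : {i | ε ≤ ‖lam i‖}.Infinite := hinf
  set s := hinf.natEmbedding
  have hcomp := hT.isCompact_closure_image_closedBall 1
  have hmem : ∀ n, T (e (s n)) ∈ closure (T '' Metric.closedBall 0 1) := fun n =>
    subset_closure ⟨_, by simp [he.1], rfl⟩
  obtain ⟨x, -, φ, hφ, hx⟩ := hcomp.tendsto_subseq hmem
  have hC := hx.cauchySeq
  rw [Metric.cauchySeq_iff] at hC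
  obtain ⟨N, hN⟩ := hC ε hε
  have h := hN N le_rfl (N + 1) (Nat.le_succ N)
  set i : ι := (s (φ N)).1 with hi
  set j : ι := (s (φ (N + 1))).1 with hj
  have hij : i ≠ j := fun hh => by
    have := hφ.injective (s.injective (Subtype.ext hh))
    omega
  have hortho : inner ℂ (lam i • e i) (lam j • e j) = 0 := by
    simp [he.2 hij]
  have hsq : ‖lam i • e i - lam j • e j‖ ^ 2 = ‖lam i‖ ^ 2 + ‖lam j‖ ^ 2 := by
    rw [@norm_sub_sq ℂ, hortho]
    simp [norm_smul, he.1]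
  have hle : ε ≤ ‖lam i‖ := (s (φ N)).2
  have h' : ‖lam i • e i - lam j • e j‖ < ε := by
    rw [← hlam, ← hlam, ← dist_eq_norm]
    exact h
  nlinarith [norm_nonneg (lam j), norm_nonneg (lam i • e i - lam j • e j)]

/-- A compact symmetric operator with positive quadratic form on an infinite-dimensional Hilbert
space has an orthonormal basis of eigenvectors whose eigenvalues decrease. -/
theorem exists_hilbertBasis_eigenvectors [CompleteSpace H] (hdim : ¬ FiniteDimensional ℂ H)
    {T : H →L[ℂ] H} (hT : IsCompactOperator T) (hsymm : (T : H →ₗ[ℂ] H).IsSymmetric)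
    (hpos : ∀ x, x ≠ 0 → 0 < (inner ℂ x (T x)).re) :
    ∃ (b : HilbertBasis ℕ ℂ H) (lam : ℕ → ℝ), (∀ n, 0 < lam n) ∧ Antitone lam ∧
      ∀ n, T (b n) = (lam n : ℂ) • b n := by
  have hfd : ∀ μ : ℂ, FiniteDimensional ℂ (Module.End.eigenspace (T : H →ₗ[ℂ] H) μ) := by
    intro μ
    by_cases hμ : μ = 0
    -- the eigenvalue zero is excluded by positivity
    · have hbot : Module.End.eigenspace (T : H →ₗ[ℂ] H) μ = ⊥ := by
        rw [eq_bot_iff]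
        intro x hx
        rw [Module.End.mem_eigenspace_iff, hμ, zero_smul] at hx
        by_contra hx0
        have := hpos x (by simpa using hx0)
        rw [show T x = 0 from hx] at this
        simp at this
      rw [hbot]
      infer_instance
    · exact ContinuousLinearMap.finite_dimensional_eigenspace hT μ hμ
  let G : ℂ → Submodule ℂ H := fun μ => Module.End.eigenspace (T : H →ₗ[ℂ] H) μ
  let β : ∀ μ : ℂ, OrthonormalBasis (Fin (Module.finrank ℂ (G μ))) ℂ (G μ) := fun μ =>
    have := hfd μ
    stdOrthonormalBasis ℂ (G μ)
  let e : (Σ μ : ℂ, Fin (Module.finrank ℂ (G μ))) → H := fun p => (β p.1 p.2 : H)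
  have he : Orthonormal ℂ e :=
    hsymm.orthogonalFamily_eigenspaces.orthonormal_sigma_orthonormal (v_family := fun μ => β μ)
      fun μ => (β μ).orthonormal
  have hspan : (Submodule.span ℂ (Set.range e))ᗮ = ⊥ := by
    rw [eq_bot_iff, ← ContinuousLinearMap.orthogonalComplement_iSup_eigenspaces_eq_bot hT hsymm]
    refine Submodule.orthogonal_le (iSup_le fun μ => ?_)
    intro x hx
    have h1 := (β μ).sum_repr ⟨x, hx⟩
    have h2 : x = ∑ i, (β μ).repr ⟨x, hx⟩ i • (β μ i : H) := by
      have := congrArg (Submodule.subtype (G μ)) h1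
      simpa using this.symm
    rw [h2]
    exact Submodule.sum_mem _ fun i _ => Submodule.smul_mem _ _
      (Submodule.subset_span ⟨⟨μ, i⟩, rfl⟩)
  have heig : ∀ p, T (e p) = p.1 • e p := fun p =>
    Module.End.mem_eigenspace_iff.1 (β p.1 p.2).2
  have hre : ∀ p : (Σ μ : ℂ, Fin (Module.finrank ℂ (G μ))),
      (p.1 : ℂ) = (p.1.re : ℂ) ∧ 0 < p.1.re := by
    intro p
    have hne : e p ≠ 0 := he.ne_zero p
    have h1 := hpos _ hne
    rw [heig, inner_smul_right, inner_self_eq_norm_sq_to_K, he.1] at h1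
    have hev : Module.End.HasEigenvalue (T : H →ₗ[ℂ] H) p.1 :=
      Module.End.hasEigenvalue_of_hasEigenvector ⟨(β p.1 p.2).2, hne⟩
    have h2 := hsymm.conj_eigenvalue_eq_self hev
    refine ⟨(Complex.conj_eq_iff_re.1 h2).symm, by simpa using h1⟩
  let b₀ := HilbertBasis.mkOfOrthogonalEqBot he hspan
  have hb₀ : ⇑b₀ = e := HilbertBasis.coe_mkOfOrthogonalEqBot he hspan
  have : Infinite (Σ μ : ℂ, Fin (Module.finrank ℂ (G μ))) := by
    by_contra hfin
    rw [not_infinite_iff_finite] at hfin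
    have := Fintype.ofFinite (Σ μ : ℂ, Fin (Module.finrank ℂ (G μ)))
    exact hdim (b₀.toOrthonormalBasis.toBasis.finiteDimensional_of_finite)
  obtain ⟨s, hs⟩ := exists_monotone_enumeration (fun p : Σ μ : ℂ, Fin (Module.finrank ℂ (G μ)) =>
    (p.1.re)⁻¹) (by
      intro c
      rcases le_or_gt c 0 with hc | hc
      · refine Set.Finite.subset Set.finite_empty fun p hp => ?_
        exact absurd (lt_of_lt_of_le (inv_pos.2 (hre p).2) hp) (not_lt.2 hc)
      · refine (he.finite_le_norm_eigenvalue hT heig (inv_pos.2 hc)).subset fun p hp => ?_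
        exact (inv_le_of_inv_le₀ (hre p).2 hp).trans (Complex.re_le_norm _))
  have hon : Orthonormal ℂ (e ∘ s) := he.comp _ s.injective
  have hsp : (Submodule.span ℂ (Set.range (e ∘ s)))ᗮ = ⊥ := by
    rw [s.surjective.range_comp, hspan]
  refine ⟨HilbertBasis.mkOfOrthogonalEqBot hon hsp, fun n => (s n).1.re, fun n => (hre _).2, ?_, ?_⟩
  · intro m n hmn
    exact (inv_le_inv₀ (hre _).2 (hre _).2).1 (hs hmn)
  · intro n
    rw [HilbertBasis.coe_mkOfOrthogonalEqBot, ← (hre (s n)).1]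
    exact heig (s n)

/-- The upper bound of the min-max principle, for an operator given through its matrix elements:
`h` is diagonal in the basis `b` with increasing nonnegative eigenvalues `E`, the vectors `ψ m` are
nonzero and orthogonal, with orthogonal images `η m = h (ψ m)` that satisfy `‖η m‖ ≤ c ‖ψ m‖`. A
nontrivial combination of `i + 1` vectors `ψ m` is orthogonal to the first `i` eigenvectors, and
comparing norms gives `E i ≤ c`. -/
theorem HilbertBasis.eigenvalue_le_of_orthogonal (b : HilbertBasis ℕ ℂ H) {E : ℕ → ℝ}
    (hE : Monotone E) (hE0 : ∀ n, 0 ≤ E n) {i : ℕ} {c : ℝ} (hc : 0 ≤ c)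
    (ψ η : Fin (i + 1) → H) (hψ0 : ∀ m, ψ m ≠ 0)
    (hψ : Pairwise fun m n => inner ℂ (ψ m) (ψ n) = 0)
    (hη : Pairwise fun m n => inner ℂ (η m) (η n) = 0)
    (hle : ∀ m, ‖η m‖ ≤ c * ‖ψ m‖)
    (hb : ∀ j m, inner ℂ (b j) (η m) = (E j : ℂ) * inner ℂ (b j) (ψ m)) : E i ≤ c := by
  -- `a` holds the coefficients of a combination orthogonal to the first `i` basis vectors
  let A : (Fin (i + 1) → ℂ) →ₗ[ℂ] (Fin i → ℂ) :=
    LinearMap.pi fun j => ∑ m, (inner ℂ (b (j : ℕ)) (ψ m)) • LinearMap.proj m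
  obtain ⟨a, ha, ha0⟩ : ∃ a ∈ LinearMap.ker A, a ≠ 0 := by
    apply Submodule.exists_mem_ne_zero_of_ne_bot
    exact LinearMap.ker_ne_bot_of_finrank_lt (by simp)
  set x := ∑ m, a m • ψ m with hx
  set y := ∑ m, a m • η m with hy
  have hxy : ∀ j, inner ℂ (b j) y = (E j : ℂ) * inner ℂ (b j) x := by
    intro j
    simp only [hx, hy, inner_sum, inner_smul_right, hb, Finset.mul_sum]
    exact Finset.sum_congr rfl fun m _ => by ring
  have hx0 : ∀ j < i, inner ℂ (b j) x = 0 := by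
    intro j hj
    have h := congrFun (LinearMap.mem_ker.1 ha) ⟨j, hj⟩
    simp only [hx, inner_sum, inner_smul_right]
    simpa [A, mul_comm] using h
  have pyth : ∀ v : Fin (i + 1) → H, (Pairwise fun m n => inner ℂ (v m) (v n) = 0) →
      ‖∑ m, a m • v m‖ ^ 2 = ∑ m, ‖a m‖ ^ 2 * ‖v m‖ ^ 2 := by
    intro v hv
    rw [@norm_sq_eq_re_inner ℂ, sum_inner]
    simp only [inner_sum, map_sum]
    refine Finset.sum_congr rfl fun m _ => ?_
    rw [Finset.sum_eq_single m]
    · rw [← norm_sq_eq_re_inner, norm_smul, mul_pow]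
    · intro n _ hn
      simp [inner_smul_left, inner_smul_right, hv hn.symm]
    · simp
  have hxpos : 0 < ‖x‖ ^ 2 := by
    rw [hx, pyth ψ hψ]
    obtain ⟨m, hm⟩ := Function.ne_iff.1 ha0
    refine Finset.sum_pos' (fun m _ => by positivity) ⟨m, Finset.mem_univ _, ?_⟩
    have h1 := norm_pos_iff.2 (hψ0 m)
    have h2 : 0 < ‖a m‖ := norm_pos_iff.2 hm
    positivity
  have hyx : ‖y‖ ^ 2 ≤ c ^ 2 * ‖x‖ ^ 2 := by
    rw [hx, hy, pyth ψ hψ, pyth η hη, Finset.mul_sum]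
    refine Finset.sum_le_sum fun m _ => ?_
    have h1 : ‖η m‖ ^ 2 ≤ (c * ‖ψ m‖) ^ 2 := by gcongr; exact hle m
    nlinarith [sq_nonneg ‖a m‖]
  have pars : ∀ v : H, HasSum (fun j => ‖inner ℂ (b j) v‖ ^ 2) (‖v‖ ^ 2) := by
    intro v
    have h := (b.hasSum_inner_mul_inner v v).mapL Complex.reCLM
    have h2 : Complex.reCLM (inner ℂ v v) = ‖v‖ ^ 2 := by
      rw [@norm_sq_eq_re_inner ℂ]; rfl
    rw [h2] at h
    refine h.congr_fun fun j => ?_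
    rw [← inner_conj_symm v (b j), Complex.conj_mul']
    simp [← Complex.ofReal_pow]
  have hcmp : (E i) ^ 2 * ‖x‖ ^ 2 ≤ ‖y‖ ^ 2 := by
    refine hasSum_le (fun j => ?_) ((pars x).mul_left ((E i) ^ 2)) (pars y)
    rcases lt_or_ge j i with hj | hj
    · simp [hxy, hx0 j hj]
    · rw [hxy, norm_mul, mul_pow]
      have h1 : E i ^ 2 ≤ ‖(E j : ℂ)‖ ^ 2 := by
        rw [Complex.norm_real, Real.norm_eq_abs, sq_abs]
        exact pow_le_pow_left₀ (hE0 i) (hE hj) 2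
      gcongr
  have : E i ^ 2 ≤ c ^ 2 := le_of_mul_le_mul_right (hcmp.trans hyx) hxpos
  exact (abs_le_of_sq_le_sq' this hc).2

end Hilbert

/-! ### Cubes, test functions and multiplication operators -/

section Basics

variable {d : ℕ} {l : ℝ}

theorem isOpen_cube (d : ℕ) (l : ℝ) : IsOpen (cube d l) := by
  have h : cube d l = ⋂ j, {x : EuclideanSpace ℝ (Fin d) | x j ∈ Set.Ioo (-(l / 2)) (l / 2)} := by
    ext x
    simp [cube]
  rw [h]
  exact isOpen_iInter_of_finite fun j => isOpen_Ioo.preimage (by fun_prop)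

theorem measurableSet_cube (d : ℕ) (l : ℝ) : MeasurableSet (cube d l) :=
  (isOpen_cube d l).measurableSet

theorem EuclideanSpace.volume_setOf_forall_mem (s : Fin d → Set ℝ) :
    volume {x : EuclideanSpace ℝ (Fin d) | ∀ j, x j ∈ s j} = ∏ j, volume (s j) := by
  have h := (EuclideanSpace.volume_preserving_symm_measurableEquiv_toLp
    (Fin d)).measure_preimage_equiv (Set.univ.pi s)
  rw [volume_pi_pi] at h
  rw [← h]
  congr 1
  ext x
  simp

theorem volume_cube (d : ℕ) (l : ℝ) : volume (cube d l) = ENNReal.ofReal l ^ d := by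
  have h := EuclideanSpace.volume_setOf_forall_mem (d := d)
    fun _ => Set.Ioo (-(l / 2)) (l / 2)
  rw [cube, h]
  simp

instance isFiniteMeasure_cubeMeasure (d : ℕ) (l : ℝ) : IsFiniteMeasure (cubeMeasure d l) := by
  refine ⟨?_⟩
  rw [cubeMeasure, Measure.restrict_apply_univ, volume_cube]
  exact ENNReal.pow_lt_top ENNReal.ofReal_lt_top

namespace IsTestFunction

variable {φ ψ : EuclideanSpace ℝ (Fin d) → ℂ}

theorem differentiable (h : IsTestFunction d l φ) : Differentiable ℝ φ :=
  h.1.differentiable (by simp)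

theorem zero : IsTestFunction d l 0 :=
  ⟨contDiff_const, HasCompactSupport.zero, by simp⟩

theorem add (hφ : IsTestFunction d l φ) (hψ : IsTestFunction d l ψ) :
    IsTestFunction d l (φ + ψ) :=
  ⟨hφ.1.add hψ.1, hφ.2.1.add hψ.2.1,
    (tsupport_add φ ψ).trans (Set.union_subset hφ.2.2 hψ.2.2)⟩

theorem const_smul (c : ℂ) (hφ : IsTestFunction d l φ) : IsTestFunction d l (c • φ) :=
  ⟨contDiff_const.smul hφ.1, hφ.2.1.smul_left (f := fun _ => c),
    (tsupport_smul_subset_right (fun _ => c) φ).trans hφ.2.2⟩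

theorem memLp_volume (hφ : IsTestFunction d l φ) : MemLp φ 2 volume :=
  hφ.1.continuous.memLp_of_hasCompactSupport hφ.2.1

theorem memLp (hφ : IsTestFunction d l φ) : MemLp φ 2 (cubeMeasure d l) :=
  hφ.memLp_volume.restrict _

theorem partialDeriv (hφ : IsTestFunction d l φ) (j : Fin d) :
    IsTestFunction d l (partialDeriv j φ) := by
  have hsub : tsupport (_root_.partialDeriv j φ) ⊆ tsupport φ :=
    tsupport_fderiv_apply_subset ℝ _
  refine ⟨?_, ?_, hsub.trans hφ.2.2⟩
  · exact (hφ.1.fderiv_right (m := (⊤ : ℕ∞)) (by simp)).clm_apply contDiff_const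
  · exact hφ.2.1.mono' (subset_trans subset_closure hsub)

theorem eq_zero_of_notMem (hφ : IsTestFunction d l φ) {x : EuclideanSpace ℝ (Fin d)}
    (hx : x ∉ cube d l) : φ x = 0 :=
  image_eq_zero_of_notMem_tsupport fun h => hx (hφ.2.2 h)

theorem integrable (hφ : IsTestFunction d l φ) : Integrable φ :=
  hφ.1.continuous.integrable_of_hasCompactSupport hφ.2.1

end IsTestFunction

theorem partialDeriv_add {φ ψ : EuclideanSpace ℝ (Fin d) → ℂ} (hφ : Differentiable ℝ φ)
    (hψ : Differentiable ℝ ψ) (j : Fin d) :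
    partialDeriv j (φ + ψ) = partialDeriv j φ + partialDeriv j ψ := by
  ext x
  simp [partialDeriv, fderiv_add (hφ x) (hψ x)]

theorem partialDeriv_const_smul {φ : EuclideanSpace ℝ (Fin d) → ℂ} (hφ : Differentiable ℝ φ)
    (c : ℂ) (j : Fin d) : partialDeriv j (c • φ) = c • partialDeriv j φ := by
  ext x
  simp [partialDeriv, fderiv_const_smul (hφ x) c]

theorem CubeL2.inner_def (u w : CubeL2 d l) :
    inner ℂ u w = ∫ x, conj (u x) * w x ∂(cubeMeasure d l) := by
  rw [L2.inner_def]
  simp only [RCLike.inner_apply, mul_comm]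

/-- A function orthogonal to all test functions vanishes. -/
theorem CubeL2.eq_zero_of_forall_testFunction {w : CubeL2 d l}
    (h : ∀ φ, IsTestFunction d l φ → ∫ x, conj (φ x) * w x ∂(cubeMeasure d l) = 0) : w = 0 := by
  have hint : LocallyIntegrableOn w (cube d l) (volume : Measure (EuclideanSpace ℝ (Fin d))) := by
    have : IntegrableOn w (cube d l) volume := (Lp.memLp w).integrable (by norm_num)
    exact this.locallyIntegrableOn
  have h0 := (isOpen_cube d l).ae_eq_zero_of_integral_contDiff_smul_eq_zero hint (by
    intro g hg hgc hgs
    have ht : IsTestFunction d l (fun x => (g x : ℂ)) := by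
      refine ⟨Complex.ofRealCLM.contDiff.comp hg, hgc.comp_left Complex.ofReal_zero, ?_⟩
      refine (closure_mono fun x hx => ?_).trans hgs
      simpa using hx
    rw [← h _ ht, ← setIntegral_eq_integral_of_forall_compl_eq_zero (s := cube d l)]
    · exact integral_congr_ae (ae_of_all _ fun x => by simp)
    · intro x hx
      rw [image_eq_zero_of_notMem_tsupport fun hh => hx (hgs hh), zero_smul])
  rw [Lp.eq_zero_iff_ae_eq_zero]
  exact (ae_restrict_iff' (measurableSet_cube d l)).2 h0

/-- Multiplication by a bounded function, as an operator on `L²`. -/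
theorem CubeL2.exists_mul_clm {m : EuclideanSpace ℝ (Fin d) → ℂ}
    (hm : MemLp m ⊤ (cubeMeasure d l)) :
    ∃ S : CubeL2 d l →L[ℂ] CubeL2 d l, ∀ u, S u =ᵐ[cubeMeasure d l] fun x => m x * u x := by
  refine ⟨(ContinuousLinearMap.mul ℂ ℂ).holderL (cubeMeasure d l) ⊤ 2 2 hm.toLp, fun u => ?_⟩
  filter_upwards [(ContinuousLinearMap.mul ℂ ℂ).coeFn_holder (r := 2) hm.toLp u, hm.coeFn_toLp]
    with x hx hx2
  simpa [hx2] using hx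

/-- `L²` of a nonempty cube in positive dimension is infinite-dimensional: it contains the
indicators of infinitely many disjoint cubes along the diagonal. -/
theorem CubeL2.not_finiteDimensional (hd : 1 ≤ d) (hl : 0 < l) :
    ¬ FiniteDimensional ℂ (CubeL2 d l) := by
  let a : ℕ → ℝ := fun n => l / 2 / (n + 1)
  have ha : StrictAnti a := strictAnti_nat_of_succ_lt fun n => by
    simp only [a]
    gcongr
    linarith
  let S : ℕ → Set (EuclideanSpace ℝ (Fin d)) := fun n => {x | ∀ j, x j ∈ Set.Ioo (a (n + 1)) (a n)}
  have hSo : ∀ n, IsOpen (S n) := fun n => by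
    have h : S n = ⋂ j, {x : EuclideanSpace ℝ (Fin d) | x j ∈ Set.Ioo (a (n + 1)) (a n)} := by
      ext x
      simp [S]
    rw [h]
    exact isOpen_iInter_of_finite fun j => isOpen_Ioo.preimage (by fun_prop)
  have hSm : ∀ n, MeasurableSet (S n) := fun n => (hSo n).measurableSet
  have hSsub : ∀ n, S n ⊆ cube d l := fun n x hx j => by
    have h1 : 0 < a (n + 1) := by positivity
    have h2 : a n ≤ a 0 := ha.antitone (Nat.zero_le n)
    have h3 : a 0 = l / 2 := by simp [a]
    exact ⟨by linarith [(hx j).1], by linarith [(hx j).2]⟩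
  have hSpos : ∀ n, cubeMeasure d l (S n) ≠ 0 := fun n => by
    rw [cubeMeasure, Measure.restrict_apply (hSm n), Set.inter_eq_self_of_subset_left (hSsub n)]
    refine ((hSo n).measure_pos volume
      ⟨WithLp.toLp 2 fun _ => (a (n + 1) + a n) / 2, fun j => ?_⟩).ne'
    have := ha (Nat.lt_succ_self n)
    simp only [Nat.succ_eq_add_one] at this
    constructor <;> simp <;> linarith
  have hSdisj : ∀ m n, m < n → S m ∩ S n = ∅ := fun m n hmn => by
    rw [Set.eq_empty_iff_forall_notMem]
    rintro x ⟨hxm, hxn⟩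
    have h1 := (hxm ⟨0, hd⟩).1
    have h2 := (hxn ⟨0, hd⟩).2
    have h3 : a n ≤ a (m + 1) := ha.antitone hmn
    linarith
  let e : ℕ → CubeL2 d l := fun n => indicatorConstLp 2 (hSm n) (measure_ne_top _ _) (1 : ℂ)
  have hinner : ∀ m n, inner ℂ (e m) (e n) = ((cubeMeasure d l).real (S m ∩ S n) : ℂ) :=
    fun m n => by
      simp only [e]
      rw [L2.inner_indicatorConstLp_indicatorConstLp]
      simp
  have hli : LinearIndependent ℂ e := by
    refine linearIndependent_of_ne_zero_of_inner_eq_zero (𝕜 := ℂ) (fun n hn => ?_) ?_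
    · have h := hinner n n
      rw [hn, inner_zero_left, Set.inter_self] at h
      refine hSpos n ?_
      have h' : (cubeMeasure d l).real (S n) = 0 := by exact_mod_cast h.symm
      rwa [measureReal_eq_zero_iff] at h'
    · intro m n hmn
      have h : S m ∩ S n = ∅ := by
        rcases lt_or_gt_of_ne hmn with h | h
        · exact hSdisj m n h
        · rw [Set.inter_comm]
          exact hSdisj n m h
      change inner ℂ (e m) (e n) = 0
      rw [hinner, h]
      simp
  intro hfin
  exact Module.Finite.not_linearIndependent_of_infinite e hli

end Basics

/-! ### Compactness: approximation of test functions by averages over a fine grid -/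

section Rellich

open scoped ENNReal

theorem sq_eLpNorm_two {α : Type*} [MeasurableSpace α] {ρ : Measure α} (g : α → ℂ) :
    eLpNorm g 2 ρ ^ 2 = ∫⁻ x, ‖g x‖ₑ ^ 2 ∂ρ := by
  have := eLpNorm_nnreal_pow_eq_lintegral (f := g) (μ := ρ) (p := 2) (by norm_num)
  simpa using this

/-- Jensen's inequality for the square, in the form of the Cauchy–Schwarz inequality. -/
theorem enorm_integral_sq_le {α : Type*} [MeasurableSpace α] {ρ : Measure α} {g : α → ℂ}
    (hg : AEStronglyMeasurable g ρ) :
    ‖∫ x, g x ∂ρ‖ₑ ^ 2 ≤ ρ Set.univ * ∫⁻ x, ‖g x‖ₑ ^ 2 ∂ρ := by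
  have h1 : ‖∫ x, g x ∂ρ‖ₑ ≤ eLpNorm g 1 ρ := by
    rw [eLpNorm_one_eq_lintegral_enorm]
    exact enorm_integral_le_lintegral_enorm g
  have h2 := eLpNorm_le_eLpNorm_mul_rpow_measure_univ (p := 1) (q := 2) (by norm_num) hg
  calc ‖∫ x, g x ∂ρ‖ₑ ^ 2
      ≤ (eLpNorm g 2 ρ * ρ Set.univ ^ (1 / (1 : ℝ≥0∞).toReal - 1 / (2 : ℝ≥0∞).toReal)) ^ 2 := by
        gcongr
        exact h1.trans h2
    _ = ρ Set.univ * ∫⁻ x, ‖g x‖ₑ ^ 2 ∂ρ := by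
        rw [mul_pow, sq_eLpNorm_two, mul_comm, ← ENNReal.rpow_natCast, ← ENNReal.rpow_mul]
        norm_num

variable {d : ℕ} {l : ℝ}

/-- The integrated square of an increment is controlled by the directional derivative: the increment
is the integral of the derivative over a segment, and Lebesgue measure is translation invariant. -/
theorem lintegral_enorm_sub_sq_le {φ : EuclideanSpace ℝ (Fin d) → ℂ} (hφ : ContDiff ℝ 1 φ)
    (h : EuclideanSpace ℝ (Fin d)) :
    ∫⁻ x, ‖φ (x + h) - φ x‖ₑ ^ 2 ≤ ∫⁻ x, ‖fderiv ℝ φ x h‖ₑ ^ 2 := by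
  have hcont : Continuous fun p : EuclideanSpace ℝ (Fin d) × ℝ => fderiv ℝ φ (p.1 + p.2 • h) h := by
    have := hφ.continuous_fderiv (by norm_num)
    fun_prop
  have hpt : ∀ x, ‖φ (x + h) - φ x‖ₑ ^ 2 ≤
      ∫⁻ t in Set.Ioc (0 : ℝ) 1, ‖fderiv ℝ φ (x + t • h) h‖ₑ ^ 2 := by
    intro x
    have hc : Continuous fun t : ℝ => fderiv ℝ φ (x + t • h) h :=
      hcont.comp (Continuous.prodMk continuous_const continuous_id)
    have hder : ∀ t : ℝ, HasDerivAt (fun t : ℝ => φ (x + t • h)) (fderiv ℝ φ (x + t • h) h) t := by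
      intro t
      have h1 : HasDerivAt (fun t : ℝ => x + t • h) h t := by
        simpa using ((hasDerivAt_id t).smul_const h).const_add x
      exact ((hφ.differentiable (by norm_num)) (x + t • h)).hasFDerivAt.comp_hasDerivAt t h1
    have hftc := intervalIntegral.integral_eq_sub_of_hasDerivAt (a := 0) (b := 1)
      (fun t _ => hder t) (hc.intervalIntegrable _ _)
    rw [intervalIntegral.integral_of_le zero_le_one] at hftc
    simp only [one_smul, zero_smul, add_zero] at hftc
    rw [← hftc]
    refine (enorm_integral_sq_le hc.aestronglyMeasurable).trans ?_
    simp
  calc ∫⁻ x, ‖φ (x + h) - φ x‖ₑ ^ 2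
      ≤ ∫⁻ x, ∫⁻ t in Set.Ioc (0 : ℝ) 1, ‖fderiv ℝ φ (x + t • h) h‖ₑ ^ 2 := lintegral_mono hpt
    _ = ∫⁻ t in Set.Ioc (0 : ℝ) 1, ∫⁻ x, ‖fderiv ℝ φ (x + t • h) h‖ₑ ^ 2 :=
        lintegral_lintegral_swap (by
          have : Measurable fun p : EuclideanSpace ℝ (Fin d) × ℝ =>
              ‖fderiv ℝ φ (p.1 + p.2 • h) h‖ₑ ^ 2 := hcont.measurable.enorm.pow_const 2
          exact this.aemeasurable)
    _ = ∫⁻ _ in Set.Ioc (0 : ℝ) 1, ∫⁻ x, ‖fderiv ℝ φ x h‖ₑ ^ 2 := by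
        refine lintegral_congr fun t => ?_
        exact lintegral_add_right_eq_self (fun x => ‖fderiv ℝ φ x h‖ₑ ^ 2) (t • h)
    _ = ∫⁻ x, ‖fderiv ℝ φ x h‖ₑ ^ 2 := by simp

theorem fderiv_apply_eq_sum_partialDeriv (φ : EuclideanSpace ℝ (Fin d) → ℂ)
    (x h : EuclideanSpace ℝ (Fin d)) : fderiv ℝ φ x h = ∑ j, (h j : ℂ) * partialDeriv j φ x := by
  have hh : h = ∑ j, h j • EuclideanSpace.single j (1 : ℝ) := by
    ext i
    simp [Finset.sum_apply, Pi.single_apply]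
  conv_lhs => rw [hh]
  simp [partialDeriv]

/-- The integrated square of the increment of a test function by a vector with entries at most
`δ`. -/
theorem lintegral_enorm_sub_sq_le_of_mem_cube {φ : EuclideanSpace ℝ (Fin d) → ℂ}
    (hφ : ContDiff ℝ 1 φ) {δ : ℝ} {h : EuclideanSpace ℝ (Fin d)} (hh : ∀ j, |h j| ≤ δ) :
    ∫⁻ x, ‖φ (x + h) - φ x‖ₑ ^ 2 ≤
      ENNReal.ofReal δ ^ 2 * (d * ∑ j, ∫⁻ x, ‖partialDeriv j φ x‖ₑ ^ 2) := by
  refine (lintegral_enorm_sub_sq_le hφ h).trans ?_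
  have hmeas : ∀ j : Fin d, Measurable fun x => ‖partialDeriv j φ x‖ₑ ^ 2 := fun j => by
    have : Continuous (partialDeriv j φ) :=
      (hφ.continuous_fderiv (by norm_num)).clm_apply continuous_const
    exact this.measurable.enorm.pow_const 2
  rw [← lintegral_finsetSum _ fun j _ => hmeas j, ← mul_assoc, ← lintegral_const_mul]
  swap
  · exact Finset.measurable_sum _ fun j _ => hmeas j
  refine lintegral_mono fun x => ?_
  rw [fderiv_apply_eq_sum_partialDeriv]
  calc ‖∑ j, (h j : ℂ) * partialDeriv j φ x‖ₑ ^ 2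
      ≤ (∑ j, ENNReal.ofReal δ * ‖partialDeriv j φ x‖ₑ) ^ 2 := by
        gcongr
        refine (enorm_sum_le _ _).trans (Finset.sum_le_sum fun j _ => ?_)
        rw [enorm_mul]
        gcongr
        rw [← ofReal_norm, Complex.norm_real]
        exact ENNReal.ofReal_le_ofReal (hh j)
    _ = ENNReal.ofReal δ ^ 2 * (∑ j, ‖partialDeriv j φ x‖ₑ) ^ 2 := by
        rw [← Finset.mul_sum, mul_pow]
    _ ≤ ENNReal.ofReal δ ^ 2 * (d * ∑ j, ‖partialDeriv j φ x‖ₑ ^ 2) := by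
        gcongr
        have := ENNReal.rpow_sum_le_const_mul_sum_rpow Finset.univ
          (fun j => ‖partialDeriv j φ x‖ₑ) (p := 2) (by norm_num)
        norm_num at this
        exact_mod_cast this
    _ = _ := by rw [mul_assoc]

/-- The half-open cell of side `δ` with lower corner `δ k`. -/
def gridCell (d : ℕ) (δ : ℝ) (k : Fin d → ℤ) : Set (EuclideanSpace ℝ (Fin d)) :=
  {x | ∀ j, x j ∈ Set.Ico (k j * δ) (k j * δ + δ)}

theorem measurableSet_gridCell (δ : ℝ) (k : Fin d → ℤ) : MeasurableSet (gridCell d δ k) := by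
  have h : gridCell d δ k = ⋂ j, {x : EuclideanSpace ℝ (Fin d) |
      x j ∈ Set.Ico (k j * δ) (k j * δ + δ)} := by
    ext x
    simp [gridCell]
  rw [h]
  refine MeasurableSet.iInter fun j => ?_
  have hm : Measurable fun x : EuclideanSpace ℝ (Fin d) => x j := by fun_prop
  exact hm measurableSet_Ico

theorem volume_gridCell (δ : ℝ) (k : Fin d → ℤ) :
    volume (gridCell d δ k) = ENNReal.ofReal δ ^ d := by
  have h := EuclideanSpace.volume_setOf_forall_mem (d := d)
    fun j => Set.Ico (k j * δ) (k j * δ + δ)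
  rw [gridCell, h]
  simp

/-- The index of the cell of side `δ` that contains `x`. -/
noncomputable def gridIndex (δ : ℝ) (x : EuclideanSpace ℝ (Fin d)) : Fin d → ℤ :=
  fun j => ⌊x j / δ⌋

theorem mem_gridCell_iff {δ : ℝ} (hδ : 0 < δ) (k : Fin d → ℤ) (x : EuclideanSpace ℝ (Fin d)) :
    x ∈ gridCell d δ k ↔ gridIndex δ x = k := by
  simp only [gridCell, gridIndex, funext_iff, Int.floor_eq_iff, Set.mem_ofPred_eq, Set.mem_Ico,
    le_div_iff₀ hδ, div_lt_iff₀ hδ, add_mul, one_mul]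

/-- A Poincaré inequality on the grid cells of side `δ`: the squared deviation of `φ` at `x` from
its mean over the cell of `x`, integrated over `x`. The cell is enlarged to `x + cube d (2 * δ)`, which
costs the ratio `2 ^ d` of the volumes and reduces the bound to that for increments of `φ`. -/
theorem lintegral_enorm_sub_cell_average_sq_le {φ : EuclideanSpace ℝ (Fin d) → ℂ}
    (hφ : ContDiff ℝ 1 φ) (hφi : Integrable φ) {δ : ℝ} (hδ : 0 < δ) :
    ∫⁻ x, ‖φ x - ((δ ^ d)⁻¹ : ℝ) • ∫ y in gridCell d δ (gridIndex δ x), φ y‖ₑ ^ 2 ≤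
      2 ^ d * (ENNReal.ofReal δ ^ 2 * (d * ∑ j, ∫⁻ x, ‖partialDeriv j φ x‖ₑ ^ 2)) := by
  set c : ℝ≥0∞ := ENNReal.ofReal δ ^ d with hc
  have hc0 : c ≠ 0 := pow_ne_zero _ (by simpa using hδ)
  have hct : c ≠ ⊤ := ENNReal.pow_ne_top ENNReal.ofReal_ne_top
  have hcr : c = ENNReal.ofReal (δ ^ d) := (ENNReal.ofReal_pow hδ.le d).symm
  set G : ℝ≥0∞ := ENNReal.ofReal δ ^ 2 * (d * ∑ j, ∫⁻ x, ‖partialDeriv j φ x‖ₑ ^ 2) with hG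
  have hpt : ∀ x, ‖φ x - ((δ ^ d)⁻¹ : ℝ) • ∫ y in gridCell d δ (gridIndex δ x), φ y‖ₑ ^ 2 ≤
      c⁻¹ * ∫⁻ h in cube d (2 * δ), ‖φ (x + h) - φ x‖ₑ ^ 2 := by
    intro x
    set Q := gridCell d δ (gridIndex δ x) with hQ
    have hxQ : x ∈ Q := (mem_gridCell_iff hδ _ x).2 rfl
    have hvQ : volume Q = c := volume_gridCell δ _
    have hrQ : volume.real Q = δ ^ d := by
      rw [Measure.real, hvQ, hcr, ENNReal.toReal_ofReal (by positivity)]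
    have h1 : φ x - ((δ ^ d)⁻¹ : ℝ) • ∫ y in Q, φ y =
        -(((δ ^ d)⁻¹ : ℝ) • ∫ y in Q, (φ y - φ x)) := by
      rw [integral_sub hφi.integrableOn (integrableOn_const (by rw [hvQ]; exact hct)),
        setIntegral_const, hrQ, smul_sub, smul_smul, inv_mul_cancel₀ (by positivity), one_smul]
      ring
    have h2 : ‖((δ ^ d)⁻¹ : ℝ)‖ₑ = c⁻¹ := by
      rw [enorm_inv (by positivity), hcr, Real.enorm_eq_ofReal (by positivity)]
    have h3 : ‖∫ y in Q, (φ y - φ x)‖ₑ ^ 2 ≤ c * ∫⁻ y in Q, ‖φ y - φ x‖ₑ ^ 2 := by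
      have := enorm_integral_sq_le (ρ := volume.restrict Q) (g := fun y => φ y - φ x)
        (hφ.continuous.sub continuous_const).aestronglyMeasurable
      rwa [Measure.restrict_apply_univ, hvQ] at this
    have h4 : ∫⁻ y in Q, ‖φ y - φ x‖ₑ ^ 2 ≤
        ∫⁻ h in cube d (2 * δ), ‖φ (x + h) - φ x‖ₑ ^ 2 := by
      rw [← lintegral_indicator (measurableSet_gridCell _ _),
        ← lintegral_indicator (measurableSet_cube _ _),
        ← lintegral_add_left_eq_self (Q.indicator fun y => ‖φ y - φ x‖ₑ ^ 2) x]
      refine lintegral_mono fun h => ?_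
      refine Set.indicator_le' (s := {h | x + h ∈ Q}) (f := fun h => ‖φ (x + h) - φ x‖ₑ ^ 2)
        (fun h hh => ?_) (fun h _ => zero_le) h
      rw [Set.indicator_of_mem]
      intro j
      have e1 := hxQ j
      have e2 : (x + h) j ∈ _ := hh j
      simp only [PiLp.add_apply, Set.mem_Ico] at e1 e2
      constructor <;> linarith
    rw [h1, enorm_neg, enorm_smul, mul_pow, h2]
    calc c⁻¹ ^ 2 * ‖∫ y in Q, (φ y - φ x)‖ₑ ^ 2
        ≤ c⁻¹ ^ 2 * (c * ∫⁻ h in cube d (2 * δ), ‖φ (x + h) - φ x‖ₑ ^ 2) := by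
          gcongr
          exact h3.trans (by gcongr)
      _ = c⁻¹ * ∫⁻ h in cube d (2 * δ), ‖φ (x + h) - φ x‖ₑ ^ 2 := by
          rw [sq, mul_assoc, ← mul_assoc c⁻¹ c, ENNReal.inv_mul_cancel hc0 hct, one_mul]
  have hmeas : Measurable fun p : EuclideanSpace ℝ (Fin d) × EuclideanSpace ℝ (Fin d) =>
      ‖φ (p.1 + p.2) - φ p.1‖ₑ ^ 2 := by
    have : Continuous fun p : EuclideanSpace ℝ (Fin d) × EuclideanSpace ℝ (Fin d) =>
        φ (p.1 + p.2) - φ p.1 := by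
      have := hφ.continuous
      fun_prop
    exact this.measurable.enorm.pow_const 2
  calc ∫⁻ x, ‖φ x - ((δ ^ d)⁻¹ : ℝ) • ∫ y in gridCell d δ (gridIndex δ x), φ y‖ₑ ^ 2
      ≤ ∫⁻ x, c⁻¹ * ∫⁻ h in cube d (2 * δ), ‖φ (x + h) - φ x‖ₑ ^ 2 := lintegral_mono hpt
    _ = c⁻¹ * ∫⁻ h in cube d (2 * δ), ∫⁻ x, ‖φ (x + h) - φ x‖ₑ ^ 2 := by
        rw [lintegral_const_mul _ hmeas.lintegral_prod_right',
          lintegral_lintegral_swap hmeas.aemeasurable]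
    _ ≤ c⁻¹ * ∫⁻ _ in cube d (2 * δ), G := by
        gcongr c⁻¹ * ?_
        refine setLIntegral_mono measurable_const fun h hh => ?_
        refine lintegral_enorm_sub_sq_le_of_mem_cube hφ fun j => abs_le.2 ?_
        have := hh j
        constructor <;> linarith [this.1, this.2]
    _ = 2 ^ d * G := by
        rw [setLIntegral_const, volume_cube, ENNReal.ofReal_mul zero_le_two, mul_pow, ← hc,
          ENNReal.ofReal_ofNat, mul_comm G, mul_comm (2 ^ d) c, mul_assoc c, ← mul_assoc c⁻¹,
          ENNReal.inv_mul_cancel hc0 hct, one_mul]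

/-- The average of an `L²` function over the grid cells of side `δ` that meet the cube, as an
operator of finite rank. -/
noncomputable def gridAverage (d : ℕ) (l δ : ℝ) : CubeL2 d l →L[ℂ] CubeL2 d l :=
  ∑ k ∈ Finset.Icc (fun _ => ⌊-(l / 2) / δ⌋ : Fin d → ℤ) (fun _ => ⌊l / 2 / δ⌋),
    (((δ ^ d)⁻¹ : ℝ) : ℂ) • (innerSL ℂ (indicatorConstLp (μ := cubeMeasure d l) 2
      (measurableSet_gridCell δ k) (measure_ne_top _ _) (1 : ℂ))).smulRight
        (indicatorConstLp 2 (measurableSet_gridCell δ k) (measure_ne_top _ _) (1 : ℂ))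

theorem isCompactOperator_gridAverage (d : ℕ) (l δ : ℝ) :
    IsCompactOperator (gridAverage d l δ) := by
  have h : gridAverage d l δ ∈ compactOperator (RingHom.id ℂ) (CubeL2 d l) (CubeL2 d l) := by
    refine Submodule.sum_mem _ fun k _ => Submodule.smul_mem _ _ ?_
    have hid : IsCompactOperator (id : ℂ → ℂ) :=
      (isCompactOperator_id_iff_finiteDimensional (𝕜 := ℂ)).2 inferInstance
    set e := indicatorConstLp (μ := cubeMeasure d l) 2 (measurableSet_gridCell δ k)
      (measure_ne_top _ _) (1 : ℂ)
    exact (hid.clm_comp ((ContinuousLinearMap.id ℂ ℂ).smulRight e)).comp_clm (innerSL ℂ e)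
  exact h

theorem gridAverage_testFunction {φ : EuclideanSpace ℝ (Fin d) → ℂ} (hφ : IsTestFunction d l φ)
    {u : CubeL2 d l} (hu : u =ᵐ[cubeMeasure d l] φ) {δ : ℝ} (hδ : 0 < δ) :
    gridAverage d l δ u =ᵐ[cubeMeasure d l]
      fun x => ((δ ^ d)⁻¹ : ℝ) • ∫ y in gridCell d δ (gridIndex δ x), φ y := by
  set K := Finset.Icc (fun _ => ⌊-(l / 2) / δ⌋ : Fin d → ℤ) (fun _ => ⌊l / 2 / δ⌋) with hK
  set e : (Fin d → ℤ) → CubeL2 d l := fun k => indicatorConstLp (μ := cubeMeasure d l) 2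
    (measurableSet_gridCell δ k) (measure_ne_top _ _) (1 : ℂ) with he
  set I : (Fin d → ℤ) → ℂ := fun k => ∫ y in gridCell d δ k, φ y with hI
  have hin : ∀ k, inner ℂ (e k) u = I k := by
    intro k
    rw [he, L2.inner_indicatorConstLp_one, integral_congr_ae (ae_restrict_of_ae hu), cubeMeasure,
      Measure.restrict_restrict (measurableSet_gridCell _ _)]
    refine (setIntegral_eq_of_subset_of_forall_sdiff_eq_zero (measurableSet_gridCell δ k)
      (t := gridCell d δ k) (s := gridCell d δ k ∩ cube d l) Set.inter_subset_left
      fun x hx => hφ.eq_zero_of_notMem fun hxc => hx.2 ⟨hx.1, hxc⟩).symm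
  have hG : gridAverage d l δ u = ∑ k ∈ K, ((((δ ^ d)⁻¹ : ℝ) : ℂ) * I k) • e k := by
    simp only [gridAverage, _root_.sum_apply, _root_.smul_apply,
      ContinuousLinearMap.smulRight_apply, innerSL_apply_apply, smul_smul]
    exact Finset.sum_congr rfl fun k _ => by rw [← hin k]
  have h1 : ∀ᵐ x ∂(cubeMeasure d l), ∀ k, ((((((δ ^ d)⁻¹ : ℝ) : ℂ) * I k) • e k : CubeL2 d l) :
      EuclideanSpace ℝ (Fin d) → ℂ) x =
      ((((δ ^ d)⁻¹ : ℝ) : ℂ) * I k) * (gridCell d δ k).indicator (fun _ => 1) x := by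
    refine ae_all_iff.2 fun k => ?_
    filter_upwards [Lp.coeFn_smul ((((δ ^ d)⁻¹ : ℝ) : ℂ) * I k) (e k),
      indicatorConstLp_coeFn (μ := cubeMeasure d l) (p := 2) (hs := measurableSet_gridCell δ k)
        (hμs := measure_ne_top _ _) (c := (1 : ℂ))] with x hx hx2
    rw [hx, Pi.smul_apply, hx2, smul_eq_mul]
  have hcube : ∀ᵐ x ∂(cubeMeasure d l), x ∈ cube d l := ae_restrict_mem (measurableSet_cube d l)
  rw [hG]
  filter_upwards [h1, hcube, Lp.coeFn_finsetSum K
    (fun k => ((((δ ^ d)⁻¹ : ℝ) : ℂ) * I k) • e k)] with x hx hxc hsum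
  rw [hsum, Finset.sum_apply, Finset.sum_congr rfl fun k _ => hx k,
    Finset.sum_eq_single (gridIndex δ x)]
  · rw [Set.indicator_of_mem ((mem_gridCell_iff hδ _ x).2 rfl), mul_one, Complex.real_smul]
  · intro k _ hk
    rw [Set.indicator_of_notMem, mul_zero]
    exact fun h => hk ((mem_gridCell_iff hδ k x).1 h).symm
  · intro hk
    refine absurd (Finset.mem_Icc.2 ⟨fun j => ?_, fun j => ?_⟩) hk
    · exact Int.floor_le_floor (by gcongr; exact (hxc j).1.le)
    · exact Int.floor_le_floor (by gcongr; exact (hxc j).2.le)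

/-- Test functions are approximated by their grid averages, uniformly on bounded sets of `H¹`. -/
theorem norm_sub_gridAverage_le {φ : EuclideanSpace ℝ (Fin d) → ℂ} (hφ : IsTestFunction d l φ)
    {u : CubeL2 d l} (hu : u =ᵐ[cubeMeasure d l] φ) {g : Fin d → CubeL2 d l}
    (hg : ∀ j, g j =ᵐ[cubeMeasure d l] partialDeriv j φ) {δ : ℝ} (hδ : 0 < δ) :
    ‖u - gridAverage d l δ u‖ ^ 2 ≤ 2 ^ d * (δ ^ 2 * (d * ∑ j, ‖g j‖ ^ 2)) := by
  have hnorm : ∀ (w : CubeL2 d l) (f : EuclideanSpace ℝ (Fin d) → ℂ), w =ᵐ[cubeMeasure d l] f →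
      ‖w‖ₑ ^ 2 = ∫⁻ x in cube d l, ‖f x‖ₑ ^ 2 := by
    intro w f h
    rw [Lp.enorm_def, sq_eLpNorm_two]
    exact lintegral_congr_ae (h.mono fun x hx => by simp [hx])
  have h1 : ‖u - gridAverage d l δ u‖ₑ ^ 2 ≤
      2 ^ d * (ENNReal.ofReal δ ^ 2 * (d * ∑ j, ‖g j‖ₑ ^ 2)) := by
    have hsub : (u - gridAverage d l δ u : CubeL2 d l) =ᵐ[cubeMeasure d l] fun x =>
        φ x - ((δ ^ d)⁻¹ : ℝ) • ∫ y in gridCell d δ (gridIndex δ x), φ y := by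
      filter_upwards [Lp.coeFn_sub u (gridAverage d l δ u), hu,
        gridAverage_testFunction hφ hu hδ] with x h h2 h3
      rw [h, Pi.sub_apply, h2, h3]
    rw [hnorm _ _ hsub]
    refine (setLIntegral_le_lintegral _ _).trans
      ((lintegral_enorm_sub_cell_average_sq_le (hφ.1.of_le (by simp)) hφ.integrable hδ).trans ?_)
    gcongr with j
    rw [hnorm _ _ (hg j), setLIntegral_eq_of_support_subset]
    intro x hx
    by_contra hxc
    simp [(hφ.partialDeriv j).eq_zero_of_notMem hxc] at hx
  have hfin : ∑ j, ‖g j‖ₑ ^ 2 ≠ ⊤ := ENNReal.sum_ne_top.2 fun j _ => by finiteness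
  have h2 := ENNReal.toReal_mono (by finiteness) h1
  simpa [ENNReal.toReal_sum, hδ.le] using h2

end Rellich

/-! ### The form domain and the resolvent -/

section FormDomain

variable {d : ℕ} {l : ℝ}

/-- The components `φ`, `√(2v) φ` and `∂ⱼφ` whose squared norms add up to the quadratic form of
`1 + 2h`, where `h = -½Δ + v`. -/
noncomputable def formVector (v : EuclideanSpace ℝ (Fin d) → ℝ)
    (φ : EuclideanSpace ℝ (Fin d) → ℂ) :
    Option (Option (Fin d)) → EuclideanSpace ℝ (Fin d) → ℂ
  | none => φ
  | some none => fun x => (√(2 * v x) : ℂ) * φ x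
  | some (some j) => partialDeriv j φ

/-- The vectors of `L²` functions that come from test functions through `formVector`. -/
def formCore (l : ℝ) (v : EuclideanSpace ℝ (Fin d) → ℝ) :
    Submodule ℂ (PiLp 2 fun _ : Option (Option (Fin d)) => CubeL2 d l) where
  carrier := {z | ∃ φ, IsTestFunction d l φ ∧ ∀ i, z i =ᵐ[cubeMeasure d l] formVector v φ i}
  zero_mem' := by
    refine ⟨0, .zero, fun i => ?_⟩
    filter_upwards [Lp.coeFn_zero ℂ 2 (cubeMeasure d l)] with x hx
    rcases i with _ | _ | j
    · simpa [formVector] using hx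
    · simpa [formVector] using hx
    · simpa [formVector, partialDeriv] using hx
  add_mem' := by
    rintro y z ⟨φ, hφ, hy⟩ ⟨ψ, hψ, hz⟩
    refine ⟨φ + ψ, hφ.add hψ, fun i => ?_⟩
    filter_upwards [Lp.coeFn_add (y i) (z i), hy i, hz i] with x hx h1 h2
    rw [PiLp.add_apply, hx, Pi.add_apply, h1, h2]
    rcases i with _ | _ | j
    · rfl
    · simp [formVector, mul_add]
    · simp [formVector, partialDeriv_add hφ.differentiable hψ.differentiable]
  smul_mem' := by
    rintro c z ⟨φ, hφ, hz⟩
    refine ⟨c • φ, hφ.const_smul c, fun i => ?_⟩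
    filter_upwards [Lp.coeFn_smul c (z i), hz i] with x hx h1
    rw [PiLp.smul_apply, hx, Pi.smul_apply, h1]
    rcases i with _ | _ | j
    · rfl
    · simp [formVector, mul_left_comm]
    · simp [formVector, partialDeriv_const_smul hφ.differentiable]

/-- The form domain `H¹₀` of `h = -½Δ + v` with the Hilbert space structure of the form of `1 + 2h`,
realized as a closed subspace of a power of `L²`. -/
noncomputable def formSpace (l : ℝ) (v : EuclideanSpace ℝ (Fin d) → ℝ) :
    Submodule ℂ (PiLp 2 fun _ : Option (Option (Fin d)) => CubeL2 d l) :=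
  (formCore l v).topologicalClosure

instance completeSpace_formSpace (l : ℝ) (v : EuclideanSpace ℝ (Fin d) → ℝ) :
    CompleteSpace (formSpace l v) :=
  inferInstanceAs (CompleteSpace (formCore l v).topologicalClosure)

theorem memLp_sqrt_potential {v : EuclideanSpace ℝ (Fin d) → ℝ} {C : ℝ}
    (hv : AEMeasurable v (cubeMeasure d l)) (hvC : ∀ᵐ x ∂(cubeMeasure d l), v x ≤ C) :
    MemLp (fun x => (√(2 * v x) : ℂ)) ⊤ (cubeMeasure d l) := by
  refine memLp_top_of_bound (C := √(2 * C)) ?_ ?_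
  · exact (Complex.measurable_ofReal.comp_aemeasurable
      ((hv.const_mul 2).sqrt)).aestronglyMeasurable
  · filter_upwards [hvC] with x hx
    rw [Complex.norm_real, Real.norm_of_nonneg (Real.sqrt_nonneg _)]
    gcongr

/-- Every test function represents an element of the form domain. -/
theorem exists_mem_formSpace {v : EuclideanSpace ℝ (Fin d) → ℝ} {C : ℝ}
    (hv : AEMeasurable v (cubeMeasure d l)) (hvC : ∀ᵐ x ∂(cubeMeasure d l), v x ≤ C)
    {φ : EuclideanSpace ℝ (Fin d) → ℂ} (hφ : IsTestFunction d l φ) :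
    ∃ z ∈ formSpace l v, ∀ i, z i =ᵐ[cubeMeasure d l] formVector v φ i := by
  have hmem : ∀ i, MemLp (formVector v φ i) 2 (cubeMeasure d l) := by
    rintro (_ | _ | j)
    · exact hφ.memLp
    · exact hφ.memLp.mul (memLp_sqrt_potential hv hvC)
    · exact (hφ.partialDeriv j).memLp
  let z : PiLp 2 fun _ : Option (Option (Fin d)) => CubeL2 d l :=
    WithLp.toLp 2 fun i => (hmem i).toLp
  have hz : ∀ i, z i =ᵐ[cubeMeasure d l] formVector v φ i := fun i => (hmem i).coeFn_toLp
  exact ⟨z, Submodule.le_topologicalClosure _ ⟨φ, hφ, hz⟩, hz⟩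

/-- A vector of the form domain consists of a function in `H¹₀` and its gradient. -/
theorem isH10Gradient_of_mem_formSpace {v : EuclideanSpace ℝ (Fin d) → ℝ}
    {z : PiLp 2 fun _ : Option (Option (Fin d)) => CubeL2 d l} (hz : z ∈ formSpace l v) :
    IsH10Gradient (z none) fun j => z (some (some j)) := by
  obtain ⟨y, hy, hlim⟩ := mem_closure_iff_seq_limit.1 hz
  choose φ hφ hyφ using hy
  have key : ∀ i, Tendsto (fun n => eLpNorm (fun x => formVector v (φ n) i x - z i x) 2
      (cubeMeasure d l)) atTop (𝓝 0) := by
    intro i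
    have h1 : Tendsto (fun n => y n i) atTop (𝓝 (z i)) :=
      ((PiLp.continuous_apply 2 _ i).tendsto z).comp hlim
    refine ((Lp.tendsto_Lp_iff_tendsto_eLpNorm' _ _).1 h1).congr fun n => eLpNorm_congr_ae ?_
    filter_upwards [hyφ n i] with x hx
    rw [Pi.sub_apply, hx]
  exact ⟨φ, hφ, key none, fun j => key (some (some j))⟩

/-- On the form domain the component `√(2v) φ` is still determined by the first component, since
multiplication by `√(2v)` is continuous. -/
theorem formSpace_mul_eq {v : EuclideanSpace ℝ (Fin d) → ℝ} {S : CubeL2 d l →L[ℂ] CubeL2 d l}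
    (hS : ∀ u, S u =ᵐ[cubeMeasure d l] fun x => (√(2 * v x) : ℂ) * u x)
    {z : PiLp 2 fun _ : Option (Option (Fin d)) => CubeL2 d l} (hz : z ∈ formSpace l v) :
    z (some none) = S (z none) := by
  have hcl : IsClosed {z : PiLp 2 fun _ : Option (Option (Fin d)) => CubeL2 d l |
      z (some none) = S (z none)} :=
    isClosed_eq (PiLp.continuous_apply 2 _ _) (S.continuous.comp (PiLp.continuous_apply 2 _ _))
  refine closure_minimal ?_ hcl hz
  rintro y ⟨φ, -, hy⟩
  refine Lp.ext ?_
  filter_upwards [hS (y none), hy none, hy (some none)] with x h1 h2 h3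
  rw [h1, h2, h3]
  rfl

/-- The embedding of the form domain into `L²`. -/
noncomputable def formEmbedding (l : ℝ) (v : EuclideanSpace ℝ (Fin d) → ℝ) :
    formSpace l v →L[ℂ] CubeL2 d l :=
  (PiLp.proj 2 (fun _ : Option (Option (Fin d)) => CubeL2 d l) none : _ →L[ℂ] _).comp
    (formSpace l v).subtypeL

/-- The bound for test functions extends to their closure, the form domain. -/
theorem norm_formEmbedding_sub_gridAverage_le (v : EuclideanSpace ℝ (Fin d) → ℝ) {δ : ℝ}
    (hδ : 0 < δ) :
    ‖formEmbedding l v - (gridAverage d l δ).comp (formEmbedding l v)‖ ≤ √(2 ^ d * d) * δ := by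
  refine ContinuousLinearMap.opNorm_le_bound _ (by positivity) fun z => ?_
  have hcl : IsClosed {z : PiLp 2 fun _ : Option (Option (Fin d)) => CubeL2 d l |
      ‖z none - gridAverage d l δ (z none)‖ ^ 2 ≤
        2 ^ d * (δ ^ 2 * (d * ∑ j, ‖z (some (some j))‖ ^ 2))} := by
    have hc := fun i => PiLp.continuous_apply 2 (fun _ : Option (Option (Fin d)) => CubeL2 d l) i
    refine isClosed_le ?_ ?_
    · exact (((hc none).sub ((gridAverage d l δ).continuous.comp (hc none))).norm.pow 2)
    · exact continuous_const.mul (continuous_const.mul (continuous_const.mul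
        (continuous_finsetSum _ fun j _ => (hc _).norm.pow 2)))
  have h1 : ‖z.1 none - gridAverage d l δ (z.1 none)‖ ^ 2 ≤
      2 ^ d * (δ ^ 2 * (d * ∑ j, ‖z.1 (some (some j))‖ ^ 2)) := by
    refine closure_minimal ?_ hcl z.2
    rintro y ⟨φ, hφ, hy⟩
    exact norm_sub_gridAverage_le hφ (hy none) (fun j => hy (some (some j))) hδ
  have h2 : ∑ j, ‖z.1 (some (some j))‖ ^ 2 ≤ ‖z‖ ^ 2 := by
    change _ ≤ ‖z.1‖ ^ 2
    rw [PiLp.norm_sq_eq_of_L2, Fintype.sum_option, Fintype.sum_option]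
    have e1 := sq_nonneg ‖z.1 none‖
    have e2 := sq_nonneg ‖z.1 (some none)‖
    linarith
  have h3 : ‖z.1 none - gridAverage d l δ (z.1 none)‖ ^ 2 ≤ (√(2 ^ d * d) * δ * ‖z‖) ^ 2 := by
    rw [mul_pow, mul_pow, Real.sq_sqrt (by positivity)]
    calc _ ≤ 2 ^ d * (δ ^ 2 * (d * ‖z‖ ^ 2)) := h1.trans (by gcongr)
      _ = _ := by ring
  exact (le_abs_self _).trans (abs_le_of_sq_le_sq h3 (by positivity))

theorem isCompactOperator_of_norm_sub_le {V H : Type*} [NormedAddCommGroup V] [NormedSpace ℂ V]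
    [NormedAddCommGroup H] [NormedSpace ℂ H] [CompleteSpace H] {J : V →L[ℂ] H}
    {A : ℕ → V →L[ℂ] H} (hA : ∀ n, IsCompactOperator (A n)) {c : ℕ → ℝ}
    (hc : Tendsto c atTop (𝓝 0)) (h : ∀ n, ‖J - A n‖ ≤ c n) : IsCompactOperator J := by
  have hlim : Tendsto A atTop (𝓝 J) := by
    rw [tendsto_iff_norm_sub_tendsto_zero]
    refine squeeze_zero (fun n => norm_nonneg _) (fun n => ?_) hc
    rw [norm_sub_rev]
    exact h n
  exact isCompactOperator_of_tendsto hlim (Eventually.of_forall hA)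

/-- The compactness theorem of Rellich: the form domain embeds compactly into `L²`. -/
theorem isCompactOperator_formEmbedding (l : ℝ) (v : EuclideanSpace ℝ (Fin d) → ℝ) :
    IsCompactOperator (formEmbedding l v) := by
  have h0 : Tendsto (fun n : ℕ => √(2 ^ d * d) * (1 / ((n : ℝ) + 1))) atTop (𝓝 0) := by
    simpa using tendsto_one_div_add_atTop_nhds_zero_nat.const_mul √(2 ^ d * d)
  exact isCompactOperator_of_norm_sub_le
    (A := fun n : ℕ => (gridAverage d l (1 / ((n : ℝ) + 1))).comp (formEmbedding l v))
    (fun n => (isCompactOperator_gridAverage d l _).comp_clm _) h0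
    fun n => norm_formEmbedding_sub_gridAverage_le v (by positivity)

/-- The inverse of `1 + 2h` for `h = -½Δ + v` with Dirichlet boundary conditions: the
composition of the embedding of the form domain with its adjoint. -/
noncomputable def formResolvent (l : ℝ) (v : EuclideanSpace ℝ (Fin d) → ℝ) :
    CubeL2 d l →L[ℂ] CubeL2 d l :=
  (formEmbedding l v).comp (ContinuousLinearMap.adjoint (formEmbedding l v))

theorem isCompactOperator_formResolvent (l : ℝ) (v : EuclideanSpace ℝ (Fin d) → ℝ) :
    IsCompactOperator (formResolvent l v) :=
  (isCompactOperator_formEmbedding l v).comp_clm _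

theorem isSymmetric_formResolvent (l : ℝ) (v : EuclideanSpace ℝ (Fin d) → ℝ) :
    (formResolvent l v : CubeL2 d l →ₗ[ℂ] CubeL2 d l).IsSymmetric :=
  (ContinuousLinearMap.isPositive_self_comp_adjoint (formEmbedding l v)).isSymmetric

/-- The quadratic form of `J J*` is `‖J* w‖²`, and `J* w = 0` only for `w = 0` because the range of
`J` contains the test functions. -/
theorem inner_formResolvent_self_pos {v : EuclideanSpace ℝ (Fin d) → ℝ} {C : ℝ}
    (hv : AEMeasurable v (cubeMeasure d l)) (hvC : ∀ᵐ x ∂(cubeMeasure d l), v x ≤ C)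
    {w : CubeL2 d l} (hw : w ≠ 0) : 0 < (inner ℂ w (formResolvent l v w)).re := by
  have hsq := ContinuousLinearMap.apply_norm_sq_eq_inner_adjoint_right
    (ContinuousLinearMap.adjoint (formEmbedding l v)) w
  rw [ContinuousLinearMap.adjoint_adjoint] at hsq
  have hne : ContinuousLinearMap.adjoint (formEmbedding l v) w ≠ 0 := by
    intro h0
    refine hw (CubeL2.eq_zero_of_forall_testFunction fun φ hφ => ?_)
    obtain ⟨z, hz, hzφ⟩ := exists_mem_formSpace hv hvC hφ
    have h1 := ContinuousLinearMap.adjoint_inner_right (formEmbedding l v) ⟨z, hz⟩ w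
    rw [h0, inner_zero_right] at h1
    rw [h1, CubeL2.inner_def]
    refine integral_congr_ae ((hzφ none).mono fun x hx => ?_)
    simp only [formEmbedding, ContinuousLinearMap.comp_apply]
    change _ = conj (z none x) * w x
    rw [hx]
    rfl
  change 0 < RCLike.re (inner ℂ w ((formEmbedding l v ∘L
    ContinuousLinearMap.adjoint (formEmbedding l v)) w))
  rw [← hsq]
  exact pow_pos (norm_pos_iff.2 hne) 2

/-- The weak form of the equation `(1 + 2h) u = w` for `u = formResolvent l v w`. -/
theorem isSchrodingerImage_formResolvent {v : EuclideanSpace ℝ (Fin d) → ℝ} {C : ℝ}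
    (hv : AEMeasurable v (cubeMeasure d l)) (hv0 : ∀ᵐ x ∂(cubeMeasure d l), 0 ≤ v x)
    (hvC : ∀ᵐ x ∂(cubeMeasure d l), v x ≤ C) (w : CubeL2 d l) :
    IsSchrodingerImage v (formResolvent l v w) ((1 / 2 : ℂ) • (w - formResolvent l v w)) := by
  obtain ⟨S, hS⟩ := CubeL2.exists_mul_clm (memLp_sqrt_potential hv hvC)
  set z := ContinuousLinearMap.adjoint (formEmbedding l v) w with hz
  have hz0 : formResolvent l v w = z.1 none := rfl
  set u := formResolvent l v w with hu
  have hSS : ∀ᵐ x ∂(cubeMeasure d l), S (S u) x = 2 * (v x : ℂ) * u x := by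
    filter_upwards [hS (S u), hS u, hv0] with x h1 h2 h3
    rw [h1, h2, ← mul_assoc, ← Complex.ofReal_mul, Real.mul_self_sqrt (by positivity)]
    push_cast
    rfl
  refine ⟨(1 / 2 : ℂ) • (w - u - S (S u)), ⟨fun j => z.1 (some (some j)),
    isH10Gradient_of_mem_formSpace z.2, fun ψ hψ => ?_⟩, ?_⟩
  · obtain ⟨y, hy, hyψ⟩ := exists_mem_formSpace hv hvC hψ
    have h1 := ContinuousLinearMap.adjoint_inner_right (formEmbedding l v) ⟨y, hy⟩ w
    rw [← hz, Submodule.coe_inner, PiLp.inner_apply, Fintype.sum_option, Fintype.sum_option] at h1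
    have h2 : inner ℂ (y (some none)) (z.1 (some none)) = inner ℂ (y none) (S (S u)) := by
      rw [formSpace_mul_eq hS z.2, ← hz0, CubeL2.inner_def, CubeL2.inner_def]
      refine integral_congr_ae ?_
      filter_upwards [hyψ none, hyψ (some none), hS (S u)] with x e1 e2 e3
      rw [e1, e2, e3]
      simp only [formVector, map_mul, Complex.conj_ofReal]
      ring
    have h3 : ∀ j, inner ℂ (y (some (some j))) (z.1 (some (some j))) =
        ∫ x, conj (partialDeriv j ψ x) * z.1 (some (some j)) x ∂(cubeMeasure d l) := by
      intro j
      rw [CubeL2.inner_def]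
      refine integral_congr_ae ((hyψ (some (some j))).mono fun x hx => ?_)
      simp only [hx]
      rfl
    have h4 : ∀ f : CubeL2 d l, ∫ x, conj (ψ x) * f x ∂(cubeMeasure d l) = inner ℂ (y none) f := by
      intro f
      rw [CubeL2.inner_def]
      refine integral_congr_ae ((hyψ none).mono fun x hx => ?_)
      simp only [hx]
      rfl
    rw [h4, inner_smul_right, inner_sub_right, inner_sub_right, ← h2,
      ← Finset.sum_congr rfl fun j _ => h3 j]
    change _ = inner ℂ (y none) w at h1
    rw [← h1, hz0]
    ring
  · filter_upwards [hSS, Lp.coeFn_smul (1 / 2 : ℂ) (w - u - S (S u)),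
      Lp.coeFn_smul (1 / 2 : ℂ) (w - u), Lp.coeFn_sub (w - u) (S (S u)), Lp.coeFn_sub w u]
      with x e1 e2 e3 e4 e5
    rw [e2, e3, Pi.smul_apply, Pi.smul_apply, e4, Pi.sub_apply, e1, smul_eq_mul, smul_eq_mul]
    ring

/-- The Dirichlet Schrödinger operator with a bounded nonnegative potential on a cube has an
orthonormal basis of eigenfunctions. -/
theorem exists_isEigenvalueSequence (hd : 1 ≤ d) (hl : 0 < l)
    {v : EuclideanSpace ℝ (Fin d) → ℝ} {C : ℝ}
    (hv : AEMeasurable v (cubeMeasure d l)) (hv0 : ∀ᵐ x ∂(cubeMeasure d l), 0 ≤ v x)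
    (hvC : ∀ᵐ x ∂(cubeMeasure d l), v x ≤ C) : ∃ E : ℕ → ℝ, IsEigenvalueSequence d l v E := by
  obtain ⟨b, lam, hpos, hanti, hb⟩ := exists_hilbertBasis_eigenvectors
    (CubeL2.not_finiteDimensional hd hl) (isCompactOperator_formResolvent l v)
    (isSymmetric_formResolvent l v) fun w hw => inner_formResolvent_self_pos hv hvC hw
  refine ⟨fun n => ((lam n)⁻¹ - 1) / 2, ?_, b, fun n => ?_⟩
  · intro m n hmn
    have := inv_anti₀ (hpos n) (hanti hmn)
    simp only
    linarith
  · have hne : (lam n : ℂ) ≠ 0 := by exact_mod_cast (hpos n).ne'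
    -- the eigenvector is the image of its multiple by `(lam n)⁻¹`
    have h := isSchrodingerImage_formResolvent hv hv0 hvC ((lam n : ℂ)⁻¹ • b n)
    rw [map_smul, hb, smul_smul, inv_mul_cancel₀ hne, one_smul] at h
    convert h using 1
    push_cast
    module

end FormDomain

/-! ### The lattice potential -/

section Potential

variable {d : ℕ}

theorem eq_of_sub_latticePoint_mem_cube {x : EuclideanSpace ℝ (Fin d)} {k k' : Fin d → ℤ}
    (h : x - latticePoint k ∈ cube d 1) (h' : x - latticePoint k' ∈ cube d 1) : k = k' := by
  ext j
  have e1 := h j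
  have e2 := h' j
  simp only [latticePoint, PiLp.sub_apply, Set.mem_Ioo] at e1 e2
  have h1 : k j < k' j + 1 := by
    have : (k j : ℝ) < k' j + 1 := by linarith
    exact_mod_cast this
  have h2 : k' j < k j + 1 := by
    have : (k' j : ℝ) < k j + 1 := by linarith
    exact_mod_cast this
  omega

theorem latticePotential_of_mem (f : EuclideanSpace ℝ (Fin d) → ℝ) (q : (Fin d → ℤ) → ℝ)
    {x : EuclideanSpace ℝ (Fin d)} {k : Fin d → ℤ} (h : x - latticePoint k ∈ cube d 1) :
    latticePotential f q x = q k * f (x - latticePoint k) := by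
  rw [latticePotential, tsum_eq_single k, Set.indicator_of_mem h]
  intro k' hk'
  rw [Set.indicator_of_notMem, mul_zero]
  exact fun h' => hk' (eq_of_sub_latticePoint_mem_cube h' h)

theorem latticePotential_of_forall_notMem (f : EuclideanSpace ℝ (Fin d) → ℝ)
    (q : (Fin d → ℤ) → ℝ) {x : EuclideanSpace ℝ (Fin d)}
    (h : ∀ k, x - latticePoint k ∉ cube d 1) : latticePotential f q x = 0 := by
  simp [latticePotential, Set.indicator_of_notMem (h _)]

/-- The potential is measurable on each cell, where it is a translate of a multiple of `f`, and it
vanishes off the countably many cells. -/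
theorem aemeasurable_latticePotential {f : EuclideanSpace ℝ (Fin d) → ℝ}
    (hf : AEMeasurable f (cubeMeasure d 1)) (q : (Fin d → ℤ) → ℝ) :
    AEMeasurable (latticePotential f q) volume := by
  let U : (Fin d → ℤ) → Set (EuclideanSpace ℝ (Fin d)) := fun k =>
    (fun x => x - latticePoint k) ⁻¹' cube d 1
  have hU : ∀ k, MeasurableSet (U k) := fun k =>
    (measurable_id.sub_const _) (measurableSet_cube d 1)
  have h1 : ∀ k, AEMeasurable (latticePotential f q) (volume.restrict (U k)) := by
    intro k
    have hmp : MeasurePreserving (fun x : EuclideanSpace ℝ (Fin d) => x - latticePoint k)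
        (volume.restrict (U k)) (cubeMeasure d 1) :=
      (measurePreserving_sub_right volume (latticePoint k)).restrict_preimage
        (measurableSet_cube d 1)
    refine ((hf.comp_quasiMeasurePreserving hmp.quasiMeasurePreserving).const_mul (q k)).congr ?_
    filter_upwards [ae_restrict_mem (hU k)] with x hx
    exact (latticePotential_of_mem f q hx).symm
  have h2 : AEMeasurable (latticePotential f q) (volume.restrict (⋃ k, U k)ᶜ) := by
    refine (aemeasurable_const (b := (0 : ℝ))).congr ?_
    filter_upwards [ae_restrict_mem (MeasurableSet.iUnion hU).compl] with x hx
    refine (latticePotential_of_forall_notMem f q fun k hk => hx ?_).symm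
    exact Set.mem_iUnion.2 ⟨k, hk⟩
  have h3 := aemeasurable_union_iff.2 ⟨aemeasurable_iUnion_iff.2 h1, h2⟩
  rwa [Set.union_compl_self, Measure.restrict_univ] at h3

/-- The potential at `x` lies between `0` and `c C` if `f` takes values in `[0, C]` and the coupling
constants of the cells near `x` take values in `[0, c]`. -/
theorem latticePotential_mem_Icc {f : EuclideanSpace ℝ (Fin d) → ℝ} {C : ℝ} (hC : 0 ≤ C)
    (hf : ∀ x ∈ cube d 1, f x ∈ Set.Icc 0 C) {q : (Fin d → ℤ) → ℝ} {c : ℝ} (hc : 0 ≤ c)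
    {x : EuclideanSpace ℝ (Fin d)}
    (hq : ∀ k, x - latticePoint k ∈ cube d 1 → q k ∈ Set.Icc 0 c) :
    latticePotential f q x ∈ Set.Icc 0 (c * C) := by
  by_cases h : ∃ k, x - latticePoint k ∈ cube d 1
  · obtain ⟨k, hk⟩ := h
    rw [latticePotential_of_mem f q hk]
    exact ⟨mul_nonneg (hq k hk).1 (hf _ hk).1,
      mul_le_mul (hq k hk).2 (hf _ hk).2 (hf _ hk).1 hc⟩
  · push Not at h
    rw [latticePotential_of_forall_notMem f q h]
    exact ⟨le_rfl, mul_nonneg hc hC⟩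

end Potential

/-! ### Testing the eigenvalue equation with test functions -/

section Testing

variable {d : ℕ} {l : ℝ}

theorem tendsto_toLp_of_tendsto_eLpNorm {f : ℕ → EuclideanSpace ℝ (Fin d) → ℂ}
    (hf : ∀ n, MemLp (f n) 2 (cubeMeasure d l)) {u : CubeL2 d l}
    (h : Tendsto (fun n => eLpNorm (fun x => f n x - u x) 2 (cubeMeasure d l)) atTop (𝓝 0)) :
    Tendsto (fun n => (hf n).toLp) atTop (𝓝 u) := by
  refine (Lp.tendsto_Lp_iff_tendsto_eLpNorm' _ _).2 (h.congr fun n => eLpNorm_congr_ae ?_)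
  filter_upwards [(hf n).coeFn_toLp] with x hx
  rw [Pi.sub_apply, hx]

theorem inner_toLp {φ : EuclideanSpace ℝ (Fin d) → ℂ} (hφ : MemLp φ 2 (cubeMeasure d l))
    (u : CubeL2 d l) : inner ℂ hφ.toLp u = ∫ x, conj (φ x) * u x ∂(cubeMeasure d l) := by
  rw [CubeL2.inner_def]
  exact integral_congr_ae (hφ.coeFn_toLp.mono fun x hx => by simp only [hx])

/-- The kinetic energy of a function in the domain of the Dirichlet Laplacian is nonnegative. -/
theorem IsKineticImage.re_inner_nonneg {u w : CubeL2 d l} (h : IsKineticImage u w) :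
    0 ≤ (inner ℂ u w).re := by
  obtain ⟨g, ⟨φ, hφ, hu, hg⟩, hw⟩ := h
  have hu' := tendsto_toLp_of_tendsto_eLpNorm (fun n => (hφ n).memLp) hu
  have hg' := fun j => tendsto_toLp_of_tendsto_eLpNorm (fun n => ((hφ n).partialDeriv j).memLp)
    (hg j)
  have h1 : Tendsto (fun n => inner ℂ (hφ n).memLp.toLp w) atTop (𝓝 (inner ℂ u w)) :=
    hu'.inner tendsto_const_nhds
  have h2 : Tendsto (fun n => (1 / 2 : ℂ) * ∑ j, inner ℂ ((hφ n).partialDeriv j).memLp.toLp (g j))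
      atTop (𝓝 ((1 / 2 : ℂ) * ∑ j, inner ℂ (g j) (g j))) :=
    (tendsto_finsetSum _ fun j _ => (hg' j).inner tendsto_const_nhds).const_mul _
  have h3 : inner ℂ u w = (1 / 2 : ℂ) * ∑ j, inner ℂ (g j) (g j) := by
    refine tendsto_nhds_unique h1 (h2.congr fun n => ?_)
    rw [inner_toLp, ← hw _ (hφ n)]
    simp only [inner_toLp]
  have h4 : (1 / 2 : ℂ) * ∑ j, inner ℂ (g j) (g j) = (((1 / 2) * ∑ j, ‖g j‖ ^ 2 : ℝ) : ℂ) := by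
    simp [inner_self_eq_norm_sq_to_K]
  rw [h3, h4, Complex.ofReal_re]
  positivity

theorem IsSchrodingerImage.re_inner_nonneg {v : EuclideanSpace ℝ (Fin d) → ℝ}
    (hv0 : ∀ᵐ x ∂(cubeMeasure d l), 0 ≤ v x) {u w : CubeL2 d l} (h : IsSchrodingerImage v u w) :
    0 ≤ (inner ℂ u w).re := by
  obtain ⟨w₀, hw₀, hw⟩ := h
  have h1 : inner ℂ u (w - w₀) = ((∫ x, v x * ‖u x‖ ^ 2 ∂(cubeMeasure d l) : ℝ) : ℂ) := by
    rw [CubeL2.inner_def, ← integral_complex_ofReal]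
    refine integral_congr_ae ?_
    filter_upwards [hw, Lp.coeFn_sub w w₀] with x h1 h2
    rw [h2, Pi.sub_apply, h1, add_sub_cancel_left, mul_left_comm, Complex.conj_mul']
    push_cast
    rfl
  have h2 : inner ℂ u w = inner ℂ u w₀ + inner ℂ u (w - w₀) := by
    rw [← inner_add_right, add_sub_cancel]
  rw [h2, h1, Complex.add_re, Complex.ofReal_re]
  refine add_nonneg hw₀.re_inner_nonneg (integral_nonneg_of_ae ?_)
  filter_upwards [hv0] with x hx
  positivity

theorem IsEigenvalueSequence.nonneg {v : EuclideanSpace ℝ (Fin d) → ℝ}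
    (hv0 : ∀ᵐ x ∂(cubeMeasure d l), 0 ≤ v x) {E : ℕ → ℝ} (hE : IsEigenvalueSequence d l v E)
    (i : ℕ) : 0 ≤ E i := by
  obtain ⟨-, b, hb⟩ := hE
  have h := (hb i).re_inner_nonneg hv0
  rw [inner_smul_right, inner_self_eq_norm_sq_to_K, b.orthonormal.1] at h
  simpa using h

/-- Integration by parts for test functions. -/
theorem integral_conj_mul_partialDeriv {φ ψ : EuclideanSpace ℝ (Fin d) → ℂ}
    (hφ : IsTestFunction d l φ) (hψ : IsTestFunction d l ψ) (j : Fin d) :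
    ∫ x, conj (ψ x) * partialDeriv j φ x ∂(cubeMeasure d l) =
      -∫ x, conj (partialDeriv j ψ x) * φ x ∂(cubeMeasure d l) := by
  have hint : ∀ {f g : EuclideanSpace ℝ (Fin d) → ℂ}, IsTestFunction d l f →
      IsTestFunction d l g → Integrable (fun x => conj (f x) * g x) := by
    intro f g hf hg
    exact ((Complex.continuous_conj.comp hf.1.continuous).mul
      hg.1.continuous).integrable_of_hasCompactSupport hg.2.1.mul_left
  have hset : ∀ {f g : EuclideanSpace ℝ (Fin d) → ℂ}, IsTestFunction d l g →
      ∫ x, conj (f x) * g x ∂(cubeMeasure d l) = ∫ x, conj (f x) * g x := by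
    intro f g hg
    refine setIntegral_eq_integral_of_forall_compl_eq_zero fun x hx => ?_
    rw [hg.eq_zero_of_notMem hx, mul_zero]
  rw [hset (hφ.partialDeriv j), hset hφ]
  let B : ℂ →L[ℝ] ℂ →L[ℝ] ℂ := (ContinuousLinearMap.mul ℝ ℂ).comp
    (Complex.conjCLE : ℂ →L[ℝ] ℂ)
  exact integral_bilinear_fderiv_right_eq_neg_left_of_integrable (B := B) (μ := volume)
    (v := EuclideanSpace.single j 1) (hint (hψ.partialDeriv j) hφ) (hint hψ (hφ.partialDeriv j))
    (hint hψ hφ) (fun x _ => hψ.differentiable x) (fun x _ => hφ.differentiable x)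

/-- The gradient of a function in `H¹₀` is its gradient in the sense of distributions. -/
theorem IsH10Gradient.integral_conj_mul {u : CubeL2 d l} {g : Fin d → CubeL2 d l}
    (h : IsH10Gradient u g) {ψ : EuclideanSpace ℝ (Fin d) → ℂ} (hψ : IsTestFunction d l ψ)
    (j : Fin d) : ∫ x, conj (ψ x) * g j x ∂(cubeMeasure d l) =
      -∫ x, conj (partialDeriv j ψ x) * u x ∂(cubeMeasure d l) := by
  obtain ⟨φ, hφ, hu, hg⟩ := h
  have hu' := tendsto_toLp_of_tendsto_eLpNorm (fun n => (hφ n).memLp) hu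
  have hg' := tendsto_toLp_of_tendsto_eLpNorm (fun n => ((hφ n).partialDeriv j).memLp) (hg j)
  have h1 : Tendsto (fun n => inner ℂ hψ.memLp.toLp ((hφ n).partialDeriv j).memLp.toLp) atTop
      (𝓝 (inner ℂ hψ.memLp.toLp (g j))) := tendsto_const_nhds.inner hg'
  have h2 : Tendsto (fun n => -inner ℂ (hψ.partialDeriv j).memLp.toLp (hφ n).memLp.toLp) atTop
      (𝓝 (-inner ℂ (hψ.partialDeriv j).memLp.toLp u)) := (tendsto_const_nhds.inner hu').neg
  rw [← inner_toLp hψ.memLp, ← inner_toLp (hψ.partialDeriv j).memLp]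
  refine tendsto_nhds_unique h1 (h2.congr fun n => ?_)
  rw [inner_toLp, inner_toLp]
  have e := integral_conj_mul_partialDeriv (hφ n) hψ j
  have c : ∀ {f g : EuclideanSpace ℝ (Fin d) → ℂ} (hg : IsTestFunction d l g),
      ∫ x, conj (f x) * hg.memLp.toLp g x ∂(cubeMeasure d l) =
        ∫ x, conj (f x) * g x ∂(cubeMeasure d l) := fun hg =>
    integral_congr_ae (hg.memLp.coeFn_toLp.mono fun x hx => by simp only [hx])
  rw [c (hφ n), c ((hφ n).partialDeriv j), e]

/-- The sum of the second partial derivatives. -/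
noncomputable def laplaceSum (φ : EuclideanSpace ℝ (Fin d) → ℂ)
    (x : EuclideanSpace ℝ (Fin d)) : ℂ :=
  ∑ j, partialDeriv j (partialDeriv j φ) x

/-- Symmetry of `h = -½Δ + v` between its domain and the test functions: `⟨ψ, h u⟩ = ⟨h ψ, u⟩`,
where `h ψ` is the classical expression. -/
theorem IsSchrodingerImage.inner_testFunction {v : EuclideanSpace ℝ (Fin d) → ℝ}
    {u w : CubeL2 d l} (h : IsSchrodingerImage v u w) {ψ : EuclideanSpace ℝ (Fin d) → ℂ}
    (hψ : IsTestFunction d l ψ) {p η : CubeL2 d l} (hp : p =ᵐ[cubeMeasure d l] ψ)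
    (hη : η =ᵐ[cubeMeasure d l] fun x => -(1 / 2 : ℂ) * laplaceSum ψ x + v x * ψ x) :
    inner ℂ p w = inner ℂ η u := by
  obtain ⟨w₀, ⟨g, hg, hw₀⟩, hw⟩ := h
  set L : Fin d → CubeL2 d l := fun j => ((hψ.partialDeriv j).partialDeriv j).memLp.toLp with hL
  have hLae : ∀ᵐ x ∂(cubeMeasure d l), ∀ j, L j x = partialDeriv j (partialDeriv j ψ) x :=
    ae_all_iff.2 fun j => ((hψ.partialDeriv j).partialDeriv j).memLp.coeFn_toLp
  have h1 : inner ℂ p w₀ = inner ℂ (-(1 / 2 : ℂ) • ∑ j, L j) u := by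
    have e : inner ℂ p w₀ = ∫ x, conj (ψ x) * w₀ x ∂(cubeMeasure d l) := by
      rw [CubeL2.inner_def]
      exact integral_congr_ae (hp.mono fun x hx => by simp only [hx])
    rw [e, ← hw₀ ψ hψ, inner_smul_left, sum_inner]
    simp only [hL, inner_toLp, hg.integral_conj_mul (hψ.partialDeriv _), Finset.sum_neg_distrib]
    simp only [map_neg, map_div₀, map_one, map_ofNat]
    ring
  have h2 : inner ℂ p (w - w₀) = inner ℂ (η - -(1 / 2 : ℂ) • ∑ j, L j) u := by
    rw [CubeL2.inner_def, CubeL2.inner_def]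
    refine integral_congr_ae ?_
    filter_upwards [hw, hp, hη, hLae, Lp.coeFn_sub w w₀, Lp.coeFn_sub η (-(1 / 2 : ℂ) • ∑ j, L j),
      Lp.coeFn_smul (-(1 / 2 : ℂ)) (∑ j, L j), Lp.coeFn_finsetSum Finset.univ L]
      with x e1 e2 e3 e4 e5 e6 e7 e8
    rw [e5, e6, Pi.sub_apply, Pi.sub_apply, e7, Pi.smul_apply, e8, Finset.sum_apply, e1, e2, e3,
      Finset.sum_congr rfl fun j _ => e4 j, laplaceSum, smul_eq_mul, add_sub_cancel_left,
      add_sub_cancel_left, map_mul, Complex.conj_ofReal]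
    ring
  calc inner ℂ p w = inner ℂ p w₀ + inner ℂ p (w - w₀) := by rw [← inner_add_right, add_sub_cancel]
    _ = inner ℂ η u := by rw [h1, h2, ← inner_add_left, add_sub_cancel]

end Testing

/-! ### Upper bounds for eigenvalues from disjointly supported test functions -/

section UpperBound

open scoped ENNReal

variable {d : ℕ} {l : ℝ}

theorem IsTestFunction.laplaceSum {φ : EuclideanSpace ℝ (Fin d) → ℂ}
    (hφ : IsTestFunction d l φ) : IsTestFunction d l (laplaceSum φ) := by
  have h : _root_.laplaceSum φ = ∑ j, _root_.partialDeriv j (_root_.partialDeriv j φ) := by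
    ext x
    simp [_root_.laplaceSum]
  rw [h]
  exact Finset.sum_induction _ (IsTestFunction d l) (fun _ _ => IsTestFunction.add)
    IsTestFunction.zero fun j _ => (hφ.partialDeriv j).partialDeriv j

theorem laplaceSum_eq_zero_of_notMem_tsupport {φ : EuclideanSpace ℝ (Fin d) → ℂ}
    {x : EuclideanSpace ℝ (Fin d)} (hx : x ∉ tsupport φ) : laplaceSum φ x = 0 := by
  refine Finset.sum_eq_zero fun j _ => ?_
  have hsub : ∀ ψ : EuclideanSpace ℝ (Fin d) → ℂ, tsupport (partialDeriv j ψ) ⊆ tsupport ψ :=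
    fun ψ => tsupport_fderiv_apply_subset ℝ _
  exact image_eq_zero_of_notMem_tsupport fun h => hx (hsub _ (hsub _ h))

/-- Test functions with disjoint supports on which the potential is at most `ε` and whose Laplacian
has relative size at most `K` bound the eigenvalues from above. -/
theorem IsEigenvalueSequence.le_of_testFunctions {v : EuclideanSpace ℝ (Fin d) → ℝ} {C : ℝ}
    (hv : AEMeasurable v (cubeMeasure d l)) (hv0 : ∀ x, 0 ≤ v x) (hvC : ∀ x, v x ≤ C)
    {E : ℕ → ℝ} (hE : IsEigenvalueSequence d l v E) {i : ℕ}
    {ψ : Fin (i + 1) → EuclideanSpace ℝ (Fin d) → ℂ} (hψ : ∀ m, IsTestFunction d l (ψ m))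
    (hψ0 : ∀ m, eLpNorm (ψ m) 2 (cubeMeasure d l) ≠ 0)
    (hdisj : Pairwise fun m n => Disjoint (tsupport (ψ m)) (tsupport (ψ n)))
    {K ε : ℝ} (hK : 0 ≤ K) (hε : 0 ≤ ε)
    (hlap : ∀ m, eLpNorm (laplaceSum (ψ m)) 2 (cubeMeasure d l) ≤
      ENNReal.ofReal K * eLpNorm (ψ m) 2 (cubeMeasure d l))
    (hvε : ∀ m, ∀ x ∈ tsupport (ψ m), v x ≤ ε) : E i ≤ K / 2 + ε := by
  have hvm : MemLp (fun x => (v x : ℂ)) ⊤ (cubeMeasure d l) := by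
    refine memLp_top_of_bound (C := C)
      (Complex.measurable_ofReal.comp_aemeasurable hv).aestronglyMeasurable ?_
    refine ae_of_all _ fun x => ?_
    rw [Complex.norm_real, Real.norm_of_nonneg (hv0 x)]
    exact hvC x
  have hW : ∀ m, MemLp (fun x => (v x : ℂ) * ψ m x) 2 (cubeMeasure d l) := fun m =>
    (hψ m).memLp.mul hvm
  let p : Fin (i + 1) → CubeL2 d l := fun m => (hψ m).memLp.toLp
  let W : Fin (i + 1) → CubeL2 d l := fun m => (hW m).toLp
  let L : Fin (i + 1) → CubeL2 d l := fun m => (hψ m).laplaceSum.memLp.toLp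
  let η : Fin (i + 1) → CubeL2 d l := fun m => (-(1 / 2 : ℂ)) • L m + W m
  have hp : ∀ m, p m =ᵐ[cubeMeasure d l] ψ m := fun m => (hψ m).memLp.coeFn_toLp
  have hη : ∀ m, η m =ᵐ[cubeMeasure d l]
      fun x => -(1 / 2 : ℂ) * laplaceSum (ψ m) x + v x * ψ m x := by
    intro m
    filter_upwards [Lp.coeFn_add ((-(1 / 2 : ℂ)) • L m) (W m), Lp.coeFn_smul (-(1 / 2 : ℂ)) (L m),
      (hW m).coeFn_toLp, (hψ m).laplaceSum.memLp.coeFn_toLp] with x e1 e2 e3 e4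
    rw [e1, Pi.add_apply, e2, Pi.smul_apply, e3, e4, smul_eq_mul]
  have hortho : ∀ {y : Fin (i + 1) → CubeL2 d l}
      {f : Fin (i + 1) → EuclideanSpace ℝ (Fin d) → ℂ}, (∀ m, y m =ᵐ[cubeMeasure d l] f m) →
      (∀ m, ∀ x ∉ tsupport (ψ m), f m x = 0) →
      Pairwise fun m n => inner ℂ (y m) (y n) = 0 := by
    intro y f hy hf m n hmn
    rw [CubeL2.inner_def, integral_eq_zero_of_ae]
    filter_upwards [hy m, hy n] with x e1 e2
    rw [e1, e2]
    by_cases hx : x ∈ tsupport (ψ m)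
    · rw [hf n x fun h => Set.disjoint_left.1 (hdisj hmn) hx h, mul_zero]
      rfl
    · rw [hf m x hx, map_zero, zero_mul]
      rfl
  have hnp : ∀ m, ‖p m‖ = (eLpNorm (ψ m) 2 (cubeMeasure d l)).toReal := fun m =>
    Lp.norm_toLp _ _
  have hnL : ∀ m, ‖L m‖ ≤ K * ‖p m‖ := by
    intro m
    have h := ENNReal.toReal_mono (ENNReal.mul_ne_top ENNReal.ofReal_ne_top
      (hψ m).memLp.eLpNorm_ne_top) (hlap m)
    rw [ENNReal.toReal_mul, ENNReal.toReal_ofReal hK, ← hnp] at h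
    exact (Lp.norm_toLp _ _).trans_le h
  have hnW : ∀ m, ‖W m‖ ≤ ε * ‖p m‖ := by
    intro m
    refine Lp.norm_le_mul_norm_of_ae_le_mul ?_
    filter_upwards [(hW m).coeFn_toLp, hp m] with x e1 e2
    rw [e1, e2, norm_mul, Complex.norm_real, Real.norm_of_nonneg (hv0 x)]
    by_cases hx : x ∈ tsupport (ψ m)
    · gcongr
      exact hvε m x hx
    · simp [image_eq_zero_of_notMem_tsupport hx]
  obtain ⟨hmono, b, hb⟩ := id hE
  refine b.eigenvalue_le_of_orthogonal hmono (hE.nonneg (ae_of_all _ hv0)) (by positivity) p η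
    (fun m h0 => ?_) (hortho hp fun m x hx => image_eq_zero_of_notMem_tsupport hx)
    (hortho hη fun m x hx => ?_) (fun m => ?_) fun j m => ?_
  · have h := hnp m
    rw [h0, norm_zero, eq_comm, ENNReal.toReal_eq_zero_iff] at h
    exact h.elim (hψ0 m) (hψ m).memLp.eLpNorm_ne_top
  · simp [laplaceSum_eq_zero_of_notMem_tsupport hx, image_eq_zero_of_notMem_tsupport hx]
  · calc ‖η m‖ ≤ ‖(-(1 / 2 : ℂ)) • L m‖ + ‖W m‖ := norm_add_le _ _
      _ = 1 / 2 * ‖L m‖ + ‖W m‖ := by rw [norm_smul]; norm_num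
      _ ≤ 1 / 2 * (K * ‖p m‖) + ε * ‖p m‖ := by gcongr <;> [exact hnL m; exact hnW m]
      _ = (K / 2 + ε) * ‖p m‖ := by ring
  · have h := (hb j).inner_testFunction (hψ m) (hp m) (hη m)
    rw [inner_smul_right] at h
    rw [← inner_conj_symm, ← h, map_mul, Complex.conj_ofReal, inner_conj_symm]

/-- The function `φ` dilated by the factor `R` and moved to the centre `c`. -/
noncomputable def dilate (φ : EuclideanSpace ℝ (Fin d) → ℂ) (R : ℝ)
    (c x : EuclideanSpace ℝ (Fin d)) : ℂ :=
  φ (R⁻¹ • (x - c))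

theorem partialDeriv_dilate {φ : EuclideanSpace ℝ (Fin d) → ℂ} (hφ : Differentiable ℝ φ) (R : ℝ)
    (c : EuclideanSpace ℝ (Fin d)) (j : Fin d) :
    partialDeriv j (dilate φ R c) = (R⁻¹ : ℂ) • dilate (partialDeriv j φ) R c := by
  ext x
  have h1 : HasFDerivAt (fun x : EuclideanSpace ℝ (Fin d) => R⁻¹ • (x - c))
      (R⁻¹ • ContinuousLinearMap.id ℝ _) x := ((hasFDerivAt_id x).sub_const c).const_smul R⁻¹
  have h2 := (hφ (R⁻¹ • (x - c))).hasFDerivAt.comp x h1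
  have h3 : fderiv ℝ (dilate φ R c) x = _ := h2.fderiv
  simp [partialDeriv, h3, dilate]

theorem laplaceSum_dilate {φ : EuclideanSpace ℝ (Fin d) → ℂ} (hφ : ContDiff ℝ (⊤ : ℕ∞) φ) (R : ℝ)
    (c : EuclideanSpace ℝ (Fin d)) :
    laplaceSum (dilate φ R c) = ((R⁻¹ : ℂ) ^ 2) • dilate (laplaceSum φ) R c := by
  have hd : ∀ {χ : EuclideanSpace ℝ (Fin d) → ℂ}, Differentiable ℝ χ →
      Differentiable ℝ (dilate χ R c) := fun h =>
    h.comp ((differentiable_id.sub_const c).const_smul R⁻¹)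
  have hφ1 : Differentiable ℝ φ := hφ.differentiable (by simp)
  have hφ2 : ∀ j, Differentiable ℝ (partialDeriv j φ) := fun j =>
    ((hφ.fderiv_right (m := (⊤ : ℕ∞)) (by simp)).clm_apply contDiff_const).differentiable (by simp)
  ext x
  simp only [laplaceSum, partialDeriv_dilate hφ1, Pi.smul_apply, smul_eq_mul, dilate,
    Finset.mul_sum]
  refine Finset.sum_congr rfl fun j _ => ?_
  rw [partialDeriv_const_smul (hd (hφ2 j)), partialDeriv_dilate (hφ2 j)]
  simp only [Pi.smul_apply, smul_eq_mul, dilate]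
  ring

theorem lintegral_comp_dilation {g : EuclideanSpace ℝ (Fin d) → ℝ≥0∞} (hg : Measurable g) {R : ℝ}
    (hR : 0 < R) (c : EuclideanSpace ℝ (Fin d)) :
    ∫⁻ x, g (R⁻¹ • (x - c)) = ENNReal.ofReal (R ^ d) * ∫⁻ x, g x := by
  rw [lintegral_sub_right_eq_self (fun x => g (R⁻¹ • x)) c,
    ← lintegral_map hg (measurable_const_smul R⁻¹), Measure.map_addHaar_smul _ (inv_ne_zero hR.ne'),
    lintegral_smul_measure, finrank_euclideanSpace_fin, inv_pow, inv_inv,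
    abs_of_nonneg (by positivity), smul_eq_mul]

theorem eLpNorm_dilate {g : EuclideanSpace ℝ (Fin d) → ℂ} (hg : Continuous g) {R : ℝ}
    (hR : 0 < R) (c : EuclideanSpace ℝ (Fin d)) :
    eLpNorm (dilate g R c) 2 volume =
      ENNReal.ofReal (R ^ d) ^ (1 / (2 : ℝ)) * eLpNorm g 2 volume := by
  have hm : Measurable fun x => ‖g x‖ₑ ^ (2 : ℝ) := hg.measurable.enorm.pow_const 2
  rw [eLpNorm_eq_lintegral_rpow_enorm_toReal two_ne_zero ENNReal.ofNat_ne_top,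
    eLpNorm_eq_lintegral_rpow_enorm_toReal two_ne_zero ENNReal.ofNat_ne_top, ENNReal.toReal_ofNat,
    ← ENNReal.mul_rpow_of_nonneg _ _ (by norm_num), ← lintegral_comp_dilation hm hR c]
  rfl

/-- There are test functions in all balls, whose Laplacian has relative size of the order of the
inverse square of the radius. -/
theorem exists_dilated_testFunctions (d : ℕ) : ∃ κ : ℝ, 0 ≤ κ ∧ ∀ (l R : ℝ)
    (c : EuclideanSpace ℝ (Fin d)), 0 < R → Metric.closedBall c (R / 2) ⊆ cube d l →
    ∃ ψ, IsTestFunction d l ψ ∧ tsupport ψ ⊆ Metric.closedBall c (R / 2) ∧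
      eLpNorm ψ 2 (cubeMeasure d l) ≠ 0 ∧
      eLpNorm (laplaceSum ψ) 2 (cubeMeasure d l) ≤
        ENNReal.ofReal (κ / R ^ 2) * eLpNorm ψ 2 (cubeMeasure d l) := by
  let β : ContDiffBump (0 : EuclideanSpace ℝ (Fin d)) := ⟨1 / 4, 1 / 2, by norm_num, by norm_num⟩
  let χ : EuclideanSpace ℝ (Fin d) → ℂ := fun x => (β x : ℂ)
  have hχs : tsupport χ ⊆ Metric.closedBall 0 (1 / 2) := by
    have : tsupport β = Metric.closedBall 0 (1 / 2) := β.tsupport_eq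
    rw [← this]
    refine closure_mono fun x hx => ?_
    simpa [χ] using hx
  have hχd : ContDiff ℝ (⊤ : ℕ∞) χ := Complex.ofRealCLM.contDiff.comp β.contDiff
  have hχ0 : eLpNorm χ 2 volume ≠ 0 := by
    intro h0
    rw [eLpNorm_eq_zero_iff hχd.continuous.aestronglyMeasurable (by norm_num)] at h0
    have h1 := (hχd.continuous.ae_eq_iff_eq volume (g := fun _ => (0 : ℂ)) continuous_const).1 h0
    have h2 := congrFun h1 0
    have h3 : β 0 = 1 := β.one_of_mem_closedBall (Metric.mem_closedBall_self (by norm_num))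
    simp [χ, h3] at h2
  have hχT : IsTestFunction d 2 χ := by
    refine ⟨hχd, .of_support_subset_isCompact (isCompact_closedBall 0 (1 / 2))
      (subset_closure.trans hχs), fun x hx j => ?_⟩
    have h1 := (PiLp.norm_apply_le x j).trans (mem_closedBall_zero_iff.1 (hχs hx))
    rw [Real.norm_eq_abs, abs_le] at h1
    constructor <;> linarith
  have hχt : eLpNorm χ 2 volume ≠ ⊤ := hχT.memLp_volume.eLpNorm_ne_top
  have hlt : eLpNorm (laplaceSum χ) 2 volume ≠ ⊤ := hχT.laplaceSum.memLp_volume.eLpNorm_ne_top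
  set κ : ℝ := (eLpNorm (laplaceSum χ) 2 volume / eLpNorm χ 2 volume).toReal with hκ
  have hκle : eLpNorm (laplaceSum χ) 2 volume ≤ ENNReal.ofReal κ * eLpNorm χ 2 volume := by
    rw [hκ, ENNReal.ofReal_toReal (ENNReal.div_ne_top hlt hχ0), ENNReal.div_mul_cancel hχ0 hχt]
  refine ⟨κ, ENNReal.toReal_nonneg, fun l R c hR hsub => ?_⟩
  have hsupp : ∀ g : EuclideanSpace ℝ (Fin d) → ℂ, tsupport g ⊆ Metric.closedBall 0 (1 / 2) →
      tsupport (dilate g R c) ⊆ Metric.closedBall c (R / 2) := by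
    intro g hg
    refine closure_minimal (fun x hx => ?_) Metric.isClosed_closedBall
    have h1 := mem_closedBall_zero_iff.1 (hg (subset_closure (a := R⁻¹ • (x - c)) hx))
    rw [norm_smul, norm_inv, Real.norm_of_nonneg hR.le, inv_mul_le_iff₀ hR] at h1
    rw [mem_closedBall_iff_norm]
    linarith
  have hψ : IsTestFunction d l (dilate χ R c) :=
    ⟨hχd.comp ((contDiff_id.sub contDiff_const).const_smul R⁻¹),
      .of_support_subset_isCompact (isCompact_closedBall c (R / 2))
        (subset_closure.trans (hsupp χ hχs)), (hsupp χ hχs).trans hsub⟩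
  have hcube : eLpNorm (dilate χ R c) 2 (cubeMeasure d l) = eLpNorm (dilate χ R c) 2 volume :=
    eLpNorm_restrict_eq_of_support_subset (subset_closure.trans hψ.2.2)
  refine ⟨dilate χ R c, hψ, hsupp χ hχs, ?_, ?_⟩
  · rw [hcube, eLpNorm_dilate hχd.continuous hR]
    refine mul_ne_zero ?_ hχ0
    simp [hR]
  · have hn : ‖(R⁻¹ : ℂ) ^ 2‖ₑ = ENNReal.ofReal (R ^ 2)⁻¹ := by
      rw [← ofReal_norm, norm_pow, norm_inv, Complex.norm_real, Real.norm_of_nonneg hR.le, inv_pow]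
    calc eLpNorm (laplaceSum (dilate χ R c)) 2 (cubeMeasure d l)
        ≤ eLpNorm (laplaceSum (dilate χ R c)) 2 volume :=
          eLpNorm_mono_measure _ Measure.restrict_le_self
      _ = ENNReal.ofReal (R ^ 2)⁻¹ * (ENNReal.ofReal (R ^ d) ^ (1 / (2 : ℝ)) *
            eLpNorm (laplaceSum χ) 2 volume) := by
          rw [laplaceSum_dilate hχd, eLpNorm_const_smul, hn,
            eLpNorm_dilate hχT.laplaceSum.1.continuous hR]
      _ ≤ ENNReal.ofReal (R ^ 2)⁻¹ * (ENNReal.ofReal (R ^ d) ^ (1 / (2 : ℝ)) *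
            (ENNReal.ofReal κ * eLpNorm χ 2 volume)) := by gcongr
      _ = ENNReal.ofReal (κ / R ^ 2) * eLpNorm (dilate χ R c) 2 (cubeMeasure d l) := by
          rw [hcube, eLpNorm_dilate hχd.continuous hR,
            show κ / R ^ 2 = κ * (R ^ 2)⁻¹ from div_eq_mul_inv _ _,
            ENNReal.ofReal_mul ENNReal.toReal_nonneg]
          ring

end UpperBound

/-! ### Large boxes with small coupling constants -/

section Boxes

/-- Among infinitely many disjoint blocks of the same size of independent identically distributed
variables there are almost surely infinitely many in which all variables lie in a set of positive
probability, by the second Borel–Cantelli lemma. -/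
theorem ae_frequently_forall_mem_block {Ω ι : Type*} [MeasurableSpace Ω] {P : Measure Ω}
    [IsProbabilityMeasure P] {q : ι → Ω → ℝ} (hq : ∀ k, Measurable (q k)) (hind : iIndepFun q P)
    {S : Set ℝ} (hS : MeasurableSet S) {p : ENNReal} (hp0 : p ≠ 0)
    (hp : ∀ k, P (q k ⁻¹' S) = p) {B : ℕ → Finset ι} {r : ℕ} (hr : ∀ n, (B n).card = r)
    (hB : Pairwise fun m n => Disjoint (B m) (B n)) :
    ∀ᵐ ω ∂P, ∃ᶠ n in atTop, ∀ k ∈ B n, q k ω ∈ S := by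
  classical
  let A : ℕ → Set Ω := fun n => ⋂ k ∈ B n, q k ⁻¹' S
  have hA : ∀ n, MeasurableSet (A n) := fun n =>
    Finset.measurableSet_biInter _ fun k _ => hq k hS
  have hprod : ∀ T : Finset ι, P (⋂ k ∈ T, q k ⁻¹' S) = p ^ T.card := by
    intro T
    rw [hind.measure_inter_preimage_eq_mul T fun _ _ => hS, Finset.prod_congr rfl fun k _ => hp k,
      Finset.prod_const]
  have hPA : ∀ n, P (A n) = p ^ r := fun n => by rw [hprod, hr]
  have hindA : iIndepSet A P := by
    refine (iIndepSet_iff_meas_biInter hA).2 fun s => ?_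
    have h1 : ⋂ n ∈ s, A n = ⋂ k ∈ s.biUnion B, q k ⁻¹' S := by
      ext ω
      simp only [A, Set.mem_iInter, Finset.mem_biUnion]
      exact ⟨fun h k ⟨n, hn, hk⟩ => h n hn k hk, fun h n hn k hk => h k ⟨n, hn, hk⟩⟩
    rw [h1, hprod, Finset.card_biUnion fun m _ n _ hmn => hB hmn,
      Finset.prod_congr rfl fun n _ => hPA n, Finset.prod_const,
      Finset.sum_congr rfl fun n _ => hr n,
      Finset.sum_const, smul_eq_mul, ← pow_mul, mul_comm]
  have hsum : ∑' n, P (A n) = ⊤ := by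
    simp only [hPA]
    exact ENNReal.tsum_const_eq_top_of_ne_zero (pow_ne_zero _ hp0)
  have h1 := measure_limsup_eq_one hA hindA hsum
  have h2 := (mem_ae_iff_prob_eq_one (MeasurableSet.measurableSet_limsup hA)).2 h1
  filter_upwards [h2] with ω hω
  refine (mem_limsup_iff_frequently_mem.1 hω).mono fun n hn => ?_
  simpa [A] using hn

variable {d : ℕ}

/-- The centre of the `n`-th box of half-width `N` in a row of adjacent boxes. -/
def boxCenter (j₀ : Fin d) (N n : ℕ) : Fin d → ℤ :=
  Pi.single j₀ ((2 * N + 1) * n : ℤ)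

/-- The lattice points of the `n`-th box of half-width `N` in a row of adjacent boxes. -/
noncomputable def latticeBox (j₀ : Fin d) (N n : ℕ) : Finset (Fin d → ℤ) :=
  Finset.Icc (fun j => boxCenter j₀ N n j - N) (fun j => boxCenter j₀ N n j + N)

theorem card_latticeBox (j₀ : Fin d) (N n : ℕ) :
    (latticeBox j₀ N n).card = (2 * N + 1) ^ d := by
  rw [latticeBox, Pi.card_Icc]
  have h : ∀ j, (Finset.Icc (boxCenter j₀ N n j - N) (boxCenter j₀ N n j + N)).card =
      2 * N + 1 := by
    intro j
    rw [Int.card_Icc]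
    omega
  simp [h]

theorem le_abs_boxCenter_sub (j₀ : Fin d) (N : ℕ) {m n : ℕ} (hmn : m ≠ n) :
    (2 * N + 1 : ℤ) ≤ |boxCenter j₀ N m j₀ - boxCenter j₀ N n j₀| := by
  have h1 : (1 : ℤ) ≤ |(m : ℤ) - n| := by
    exact Int.one_le_abs (by omega)
  simp only [boxCenter, Pi.single_eq_same]
  rw [← mul_sub, abs_mul, abs_of_pos (by positivity : (0 : ℤ) < 2 * N + 1)]
  nlinarith

theorem disjoint_latticeBox (j₀ : Fin d) (N : ℕ) :
    Pairwise fun m n => Disjoint (latticeBox j₀ N m) (latticeBox j₀ N n) := by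
  intro m n hmn
  rw [Finset.disjoint_left]
  intro k hm hn
  have h1 := Finset.mem_Icc.1 hm
  have h2 := Finset.mem_Icc.1 hn
  have e1 := h1.1 j₀
  have e2 := h1.2 j₀
  have e3 := h2.1 j₀
  have e4 := h2.2 j₀
  have h := le_abs_boxCenter_sub j₀ N hmn
  rcases le_abs.1 h with h | h <;> linarith

/-- In the ball of radius `N / 2` about the centre of a box of half-width `N`, the potential
involves only the coupling constants of the box: `N / 2 + 1 / 2 ≤ N`. -/
theorem mem_latticeBox_of_mem_closedBall {j₀ : Fin d} {N n : ℕ} (hN : 1 ≤ N)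
    {x : EuclideanSpace ℝ (Fin d)}
    (hx : x ∈ Metric.closedBall (latticePoint (boxCenter j₀ N n)) (N / 2 : ℝ)) {k : Fin d → ℤ}
    (hk : x - latticePoint k ∈ cube d 1) : k ∈ latticeBox j₀ N n := by
  have hN' : (1 : ℝ) ≤ N := by exact_mod_cast hN
  have key : ∀ j, |(boxCenter j₀ N n j : ℝ) - k j| ≤ N := by
    intro j
    have h1 := (PiLp.norm_apply_le (x - latticePoint (boxCenter j₀ N n)) j).trans
      (mem_closedBall_iff_norm.1 hx)
    have h2 := hk j
    simp only [latticePoint, PiLp.sub_apply, Set.mem_Ioo, Real.norm_eq_abs, abs_le] at h1 h2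
    rw [abs_le]
    constructor <;> linarith
  refine Finset.mem_Icc.2 ⟨fun j => ?_, fun j => ?_⟩
  · have h := (abs_le.1 (key j)).2
    have h' : boxCenter j₀ N n j - k j ≤ (N : ℤ) := by exact_mod_cast h
    linarith
  · have h := (abs_le.1 (key j)).1
    have h' : -(N : ℤ) ≤ boxCenter j₀ N n j - k j := by exact_mod_cast h
    linarith

theorem disjoint_closedBall_boxCenter (j₀ : Fin d) {N m n : ℕ} (hmn : m ≠ n) :
    Disjoint (Metric.closedBall (latticePoint (boxCenter j₀ N m)) (N / 2 : ℝ))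
      (Metric.closedBall (latticePoint (boxCenter j₀ N n)) (N / 2 : ℝ)) := by
  refine Metric.closedBall_disjoint_closedBall ?_
  have h1 : (2 * N + 1 : ℝ) ≤ |(boxCenter j₀ N m j₀ : ℝ) - boxCenter j₀ N n j₀| := by
    exact_mod_cast le_abs_boxCenter_sub j₀ N hmn
  have h2 := PiLp.norm_apply_le
    (latticePoint (boxCenter j₀ N m) - latticePoint (boxCenter j₀ N n)) j₀
  simp only [latticePoint, PiLp.sub_apply, Real.norm_eq_abs] at h2
  rw [dist_eq_norm]
  have h3 : (0 : ℝ) ≤ N := Nat.cast_nonneg N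
  simp only [latticePoint]
  linarith

theorem closedBall_boxCenter_subset_cube (j₀ : Fin d) {N n : ℕ} {l : ℝ}
    (hl : (2 * ((2 * N + 1) * n + N) : ℝ) < l) :
    Metric.closedBall (latticePoint (boxCenter j₀ N n)) (N / 2 : ℝ) ⊆ cube d l := by
  intro x hx j
  have h1 := (PiLp.norm_apply_le (x - latticePoint (boxCenter j₀ N n)) j).trans
    (mem_closedBall_iff_norm.1 hx)
  simp only [latticePoint, PiLp.sub_apply, Real.norm_eq_abs, abs_le] at h1
  have h2 : (0 : ℝ) ≤ boxCenter j₀ N n j ∧ (boxCenter j₀ N n j : ℝ) ≤ (2 * N + 1) * n := by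
    rcases eq_or_ne j j₀ with rfl | h
    · simp only [boxCenter, Pi.single_eq_same]
      push_cast
      exact ⟨by positivity, le_rfl⟩
    · simp only [boxCenter, Pi.single_eq_of_ne h, Int.cast_zero]
      exact ⟨le_rfl, by positivity⟩
  have h3 : (0 : ℝ) ≤ N := Nat.cast_nonneg N
  constructor <;> linarith [h2.1, h2.2, h1.1, h1.2]

end Boxes

/-- If every size of box occurs infinitely often with arbitrarily small coupling constants, then all
eigenvalues tend to zero. -/
theorem tendsto_eigenvalue_zero {d : ℕ} (j₀ : Fin d) {f : EuclideanSpace ℝ (Fin d) → ℝ}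
    (hf_meas : AEMeasurable f (cubeMeasure d 1)) {C : ℝ} (hC : 0 < C)
    (hf : ∀ x ∈ cube d 1, f x ∈ Set.Icc 0 C) {q : (Fin d → ℤ) → ℝ} {a : ℝ}
    (hq : ∀ k, q k ∈ Set.Icc 0 a)
    (hbox : ∀ N n : ℕ, ∃ᶠ m in atTop, ∀ k ∈ latticeBox j₀ N m, q k ∈ Set.Iio (1 / ((n : ℝ) + 1)))
    {E : ℝ → ℕ → ℝ} (hE : ∀ l : ℝ, 1 ≤ l → IsEigenvalueSequence d l (latticePotential f q) (E l))
    (i : ℕ) : Tendsto (fun l : ℝ => E l i) atTop (𝓝 0) := by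
  have ha : 0 ≤ a := (hq 0).1.trans (hq 0).2
  have hv : ∀ x, latticePotential f q x ∈ Set.Icc 0 (a * C) := fun x =>
    latticePotential_mem_Icc hC.le hf ha fun k _ => hq k
  obtain ⟨κ, hκ, hbump⟩ := exists_dilated_testFunctions d
  rw [Metric.tendsto_atTop]
  intro ε hε
  -- the width `N` makes the kinetic energy small, the bound `1 / (n + 1)` the potential energy
  obtain ⟨N, hN⟩ := exists_nat_gt (max 1 (κ / ε))
  have hN1 : (1 : ℝ) < N := (le_max_left _ _).trans_lt hN
  have hNpos : (0 : ℝ) < N := zero_lt_one.trans hN1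
  have hNκ : κ / (N : ℝ) ^ 2 < ε := by
    have h1 : κ / ε < N := (le_max_right _ _).trans_lt hN
    rw [div_lt_iff₀ hε] at h1
    rw [div_lt_iff₀ (by positivity)]
    nlinarith
  obtain ⟨n, hn⟩ := exists_nat_one_div_lt (show 0 < ε / 2 / C by positivity)
  obtain ⟨s, hs, hsq⟩ := extraction_of_frequently_atTop (hbox N n)
  refine ⟨max 1 (2 * ((2 * N + 1) * s i + N) + 1), fun l hl => ?_⟩
  have hl1 : 1 ≤ l := (le_max_left _ _).trans hl
  have hsub : ∀ m : Fin (i + 1),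
      Metric.closedBall (latticePoint (boxCenter j₀ N (s m))) (N / 2 : ℝ) ⊆ cube d l := by
    intro m
    refine closedBall_boxCenter_subset_cube j₀ ?_
    have h1 : (2 * ((2 * N + 1) * s i + N) + 1 : ℝ) ≤ l := (le_max_right _ _).trans hl
    have h2 : (s m : ℝ) ≤ s i := by exact_mod_cast hs.monotone (Nat.lt_succ_iff.1 m.2)
    have h3 : ((2 * N + 1) * s m : ℝ) ≤ (2 * N + 1) * s i := by gcongr
    linarith
  choose ψ hψ hψs hψ0 hψl using fun m : Fin (i + 1) => hbump l N _ hNpos (hsub m)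
  have hle := (hE l hl1).le_of_testFunctions (aemeasurable_latticePotential hf_meas q).restrict
    (fun x => (hv x).1) (fun x => (hv x).2) hψ hψ0 (fun m m' hmm => ?_)
    (K := κ / (N : ℝ) ^ 2) (ε := 1 / ((n : ℝ) + 1) * C) (by positivity) (by positivity) hψl
    fun m x hx => ?_
  · have h0 := (hE l hl1).nonneg (ae_of_all _ fun x => (hv x).1) i
    rw [lt_div_iff₀ hC] at hn
    rw [Real.dist_eq, sub_zero, abs_of_nonneg h0]
    linarith
  · refine (disjoint_closedBall_boxCenter j₀ fun h => hmm ?_).mono (hψs m) (hψs m')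
    exact Fin.ext (hs.injective h)
  · refine (latticePotential_mem_Icc hC.le hf (by positivity) fun k hk => ⟨(hq k).1, ?_⟩).2
    exact (hsq m k (mem_latticeBox_of_mem_closedBall (by exact_mod_cast hN1.le) (hψs m hx) hk)).le

theorem mainTheorem4 {d : ℕ} (hd : 1 ≤ d)
    -- the single-site potential: bounded, and bounded below by a positive constant
    (f : EuclideanSpace ℝ (Fin d) → ℝ)
    (hf_meas : AEMeasurable f (cubeMeasure d 1))
    (hf_bdd : ∃ C : ℝ, ∀ x ∈ cube d 1, |f x| ≤ C)
    (hf_pos : ∃ σ : ℝ, 0 < σ ∧ ∀ x ∈ cube d 1, σ ≤ f x)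
    -- the single-site probability measure: support `[0, a]`, Hölder continuous
    (μ : Measure ℝ) [IsProbabilityMeasure μ]
    (a : ℝ) (hμ_supp : μ.support = Set.Icc 0 a)
    (hμ_holder : ∃ α : ℝ, 0 < α ∧ ∀ η : ℝ, 0 ≤ η → η ≤ 1 →
      ∀ s t : ℝ, 0 ≤ t - s → t - s ≤ η → μ.real (Set.Icc s t) ≤ η ^ α)
    -- the i.i.d. coupling constants
    {Ω : Type*} [MeasurableSpace Ω] (P : Measure Ω) [IsProbabilityMeasure P]
    (q : (Fin d → ℤ) → Ω → ℝ) (hq_meas : ∀ k, Measurable (q k))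
    (hq_indep : iIndepFun q P) (hq_law : ∀ k, P.map (q k) = μ) :
    ∀ᵐ ω ∂P,
      (∀ l : ℝ, 1 ≤ l →
        ∃ E : ℕ → ℝ, IsEigenvalueSequence d l (latticePotential f (fun k => q k ω)) E) ∧
      ∀ E : ℝ → ℕ → ℝ,
        (∀ l : ℝ, 1 ≤ l →
          IsEigenvalueSequence d l (latticePotential f (fun k => q k ω)) (E l)) →
        ∀ i : ℕ, Tendsto (fun l : ℝ => E l i) atTop (𝓝 0) := by
  obtain ⟨C₀, hC₀⟩ := hf_bdd
  obtain ⟨σ, hσ, hfσ⟩ := hf_pos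
  have hf : ∀ x ∈ cube d 1, f x ∈ Set.Icc 0 (max C₀ 1) := fun x hx =>
    ⟨hσ.le.trans (hfσ x hx), (le_abs_self _).trans ((hC₀ x hx).trans (le_max_left _ _))⟩
  have hC : 0 < max C₀ 1 := lt_max_of_lt_right one_pos
  have hsupp : ∀ᵐ t ∂μ, t ∈ Set.Icc 0 a := by
    rw [← hμ_supp]
    exact Measure.support_mem_ae
  have ha : 0 ≤ a := by
    obtain ⟨t, ht⟩ := hsupp.exists
    exact ht.1.trans ht.2
  have hqIcc : ∀ᵐ ω ∂P, ∀ k, q k ω ∈ Set.Icc 0 a := by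
    refine ae_all_iff.2 fun k => ?_
    rw [← hq_law k] at hsupp
    exact ae_of_ae_map (hq_meas k).aemeasurable hsupp
  have hpos : ∀ n : ℕ, μ (Set.Iio (1 / ((n : ℝ) + 1))) ≠ 0 := fun n => by
    have h0 : (0 : ℝ) ∈ μ.support := hμ_supp ▸ ⟨le_rfl, ha⟩
    exact ((Measure.mem_support_iff_forall 0).1 h0 _ (Iio_mem_nhds (by positivity))).ne'
  have hbox : ∀ᵐ ω ∂P, ∀ N n : ℕ, ∃ᶠ m in atTop,
      ∀ k ∈ latticeBox (⟨0, hd⟩ : Fin d) N m, q k ω ∈ Set.Iio (1 / ((n : ℝ) + 1)) := by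
    refine ae_all_iff.2 fun N => ae_all_iff.2 fun n => ?_
    refine ae_frequently_forall_mem_block hq_meas hq_indep measurableSet_Iio (hpos n) (fun k => ?_)
      (card_latticeBox _ N) (disjoint_latticeBox _ N)
    rw [← hq_law k, Measure.map_apply (hq_meas k) measurableSet_Iio]
  filter_upwards [hqIcc, hbox] with ω hω hωbox
  refine ⟨fun l hl => ?_, fun E hE i => ?_⟩
  · have hv : ∀ x, latticePotential f (fun k => q k ω) x ∈ Set.Icc 0 (a * max C₀ 1) := fun x =>
      latticePotential_mem_Icc hC.le hf ha fun k _ => hω k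
    exact exists_isEigenvalueSequence hd (one_pos.trans_le hl)
      (aemeasurable_latticePotential hf_meas _).restrict
      (ae_of_all _ fun x => (hv x).1) (ae_of_all _ fun x => (hv x).2)
  · exact tendsto_eigenvalue_zero ⟨0, hd⟩ hf_meas hC hf hω hωbox hE i
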